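/- Fix the orthonormal (incoherent) basis $|1\rangle,\dots,|d\rangle$ of $\mathcal H_A=\mathbb C^d$, and on $\mathcal H_A\otimes\mathcal H_C$ use the product basis. Incoherent states are the diagonal density matrices. An operator $K$ is *incoherent-preserving* if $K\delta K^\dagger/\operatorname{Tr}(K\delta K^\dagger)$ is incoherent for every incoherent $\delta$ with $\operatorname{Tr}(K\delta K^\dagger)\ne0$. IO (resp. SIO) is the class of channels $\Lambda(\rho)=\sum_nK_n\rho K_n^\dagger$, $\sum_nK_n^\dagger K_n=\mathbb I$, with all $K_n$ (resp. all $K_n$ and all $K_n^\dagger$) incoherent-preserving. Let $|\Psi_N\rangle=N^{-1/2}\sum_{i=1}^N|i\rangle\in\mathcal H_A$ for $1\le N\le d$, and $\mathrm P(\rho,\sigma)=\sqrt{1-\mathrm F(\rho,\sigma)^2}$ with $\mathrm F(\rho,\sigma)=\operatorname{Tr}\sqrt{\sqrt\rho\,\sigma\sqrt\rho}$. Write $\psi=|\psi\rangle\langle\psi|$; logarithms are to base $2$. For $\mathcal O\in\{\mathrm{IO},\mathrm{SIO}\}$, $\varepsilon\ge0$, a state $\rho$ on $\mathcal H_A$ and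 a unit vector $|\phi\rangle\in\mathcal H_A$: - $C^\varepsilon_{\mathcal O,d}(\rho)$ is the maximum of $\log N$ over $1\le N\le d$ such that $\mathrm P(\Lambda(\rho),\Psi_N)\le\varepsilon$ for some $\Lambda\in\mathcal O$ on $\mathcal H_A$; $\tilde C^\varepsilon_{\mathcal O,d}(\phi)$ is the same maximum for $\rho=\phi$ with $\Lambda(\phi)$ required to be pure. - $C^\varepsilon_{\mathcal O,pc}(\rho)$ is the maximum of $\log N$ over $1\le N\le d$ for which there are a finite-dimensional $\mathcal H_C$, a unit vector $|\omega\rangle\in\mathcal H_C$ and $\Lambda\in\mathcal O$ on $\mathcal H_A\otimes\mathcal H_C$ with $\operatorname{Tr}_A\Lambda(\rho\otimes\omega)=\omega$ and $\mathrm P(\operatorname{Tr}_C\Lambda(\rho\otimes\omega),\Psi_N)\le\varepsilon$; $\tilde C^\varepsilon_{\mathcal O,pc}(\phi)$ is the same maximum for $\rho=\phi$ with $\operatorname{Tr}_C\Lambda(\phi\otimes\omega)$ required to be pure. **Theorem.** Let $|\phi\rangle\in\mathcal H_A$ be a unit vector with $r>1$ non-zero coefficients in the incoherent basis, and let $\phi_{\max}=\max_i|\langle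 i|\phi\rangle|^2$. The maxima defining $\tilde C^\varepsilon_{\mathcal O,d}(\phi)$, $\tilde C^\varepsilon_{\mathcal O,pc}(\phi)$ for $\varepsilon\ge0$, and $C^0_{\mathcal O,d}(\phi)$, $C^0_{\mathcal O,pc}(\phi)$, exist, and: 1. For every $\varepsilon\ge0$ with $r(r-1)\varepsilon\le1$, $$\tilde C^\varepsilon_{\mathrm{IO},d}(\phi)\le\tilde C^\varepsilon_{\mathrm{IO},pc}(\phi)\le\tilde C^{\sqrt{r(r-1)\varepsilon}}_{\mathrm{IO},d}(\phi),\qquad \tilde C^\varepsilon_{\mathrm{IO},d}(\phi)=\tilde C^\varepsilon_{\mathrm{SIO},d}(\phi),\qquad \tilde C^\varepsilon_{\mathrm{IO},pc}(\phi)=\tilde C^\varepsilon_{\mathrm{SIO},pc}(\phi).$$ 2. For exact distillation and $\mathcal O\in\{\mathrm{IO},\mathrm{SIO}\}$, $$C^0_{\mathcal O,d}(\phi)=C^0_{\mathcal O,pc}(\phi)=\tilde C^0_{\mathcal O,d}(\phi)=\tilde C^0_{\mathcal O,pc}(\phi)=\log\lfloor1/\phi_{\max}\rfloor .$$ -/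

import Mathlib

open scoped ComplexOrder Kronecker MatrixOrder Matrix.Norms.L2Operator

noncomputable section

namespace Coherence

/-- Density matrices. -/
def IsState {ι : Type} [Fintype ι] (ρ : Matrix ι ι ℂ) : Prop :=
  ρ.PosSemidef ∧ ρ.trace = 1

/-- Incoherent states: diagonal density matrices `∑ i, p i |i⟩⟨i|`. -/
def IsIncoherentState {ι : Type} [Fintype ι] [DecidableEq ι] (δ : Matrix ι ι ℂ) : Prop :=
  ∃ p : ι → ℝ, (∀ i, 0 ≤ p i) ∧ ∑ i, p i = 1 ∧ δ = Matrix.diagonal fun i => (p i : ℂ)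

/-- `K` sends every incoherent state `δ` to an incoherent state after normalization
(whenever the outcome has non-zero probability `Tr (K δ K†)`). -/
def IsIncoherentPreserving {ι : Type} [Fintype ι] [DecidableEq ι] (K : Matrix ι ι ℂ) : Prop :=
  ∀ δ : Matrix ι ι ℂ, IsIncoherentState δ → (K * δ * K.conjTranspose).trace ≠ 0 →
    IsIncoherentState ((K * δ * K.conjTranspose).trace⁻¹ • (K * δ * K.conjTranspose))

/-- `K` is a Kraus representation of the map `Λ`, which is trace preserving. -/
def IsKraus {ι : Type} [Fintype ι] [DecidableEq ι] {k : ℕ} (K : Fin k → Matrix ι ι ℂ)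
    (Λ : Matrix ι ι ℂ → Matrix ι ι ℂ) : Prop :=
  ∑ n, (K n).conjTranspose * K n = 1 ∧ ∀ X, Λ X = ∑ n, K n * X * (K n).conjTranspose

/-- The two classes of free operations: incoherent and strictly incoherent operations. -/
inductive OpClass : Type
  | incoherent : OpClass
  | strictlyIncoherent : OpClass

/-- `O.Mem Λ`: the map `Λ` is a channel of the class `O`. -/
def OpClass.Mem {ι : Type} [Fintype ι] [DecidableEq ι] (O : OpClass)
    (Λ : Matrix ι ι ℂ → Matrix ι ι ℂ) : Prop :=
  match O with
  | .incoherent => ∃ (k : ℕ) (K : Fin k → Matrix ι ι ℂ), IsKraus K Λ ∧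
      ∀ n, IsIncoherentPreserving (K n)
  | .strictlyIncoherent => ∃ (k : ℕ) (K : Fin k → Matrix ι ι ℂ), IsKraus K Λ ∧
      ∀ n, IsIncoherentPreserving (K n) ∧ IsIncoherentPreserving (K n).conjTranspose

/-- The rank-one operator `|ψ⟩⟨ψ|`. -/
def proj {ι : Type} [Fintype ι] (ψ : EuclideanSpace ℂ ι) : Matrix ι ι ℂ :=
  Matrix.of fun i j => ψ i * star (ψ j)

/-- The maximally coherent state `Ψ_N = N^{-1/2} ∑_{i < N} |i⟩` inside the `d`-dimensional
space (used for `1 ≤ N ≤ d`). -/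
def maxCoherent (d N : ℕ) : EuclideanSpace ℂ (Fin d) :=
  WithLp.toLp 2 fun i => if (i : ℕ) < N then ((1 / Real.sqrt N : ℝ) : ℂ) else 0

/-- Fidelity `F(ρ,σ) = Tr √(√ρ σ √ρ)`. -/
def fidelity {ι : Type} [Fintype ι] [DecidableEq ι] (ρ σ : Matrix ι ι ℂ) : ℝ :=
  (CFC.sqrt (CFC.sqrt ρ * σ * CFC.sqrt ρ)).trace.re

/-- Purified distance `P(ρ,σ) = √(1 - F(ρ,σ)²)`. -/
def purifiedDist {ι : Type} [Fintype ι] [DecidableEq ι] (ρ σ : Matrix ι ι ℂ) : ℝ :=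
  Real.sqrt (1 - fidelity ρ σ ^ 2)

/-- Partial trace over the first tensor factor (the system of interest). -/
def traceA {α β : Type} [Fintype α] (X : Matrix (α × β) (α × β) ℂ) : Matrix β β ℂ :=
  Matrix.of fun j j' => ∑ i, X (i, j) (i, j')

/-- Partial trace over the second tensor factor (the catalyst). -/
def traceC {α β : Type} [Fintype β] (X : Matrix (α × β) (α × β) ℂ) : Matrix α α ℂ :=
  Matrix.of fun i i' => ∑ j, X (i, j) (i', j)

/-- Feasible `N` for one-shot distillation from `ρ` with error `ε`. -/
def distillSet (O : OpClass) (ε : ℝ) {d : ℕ} (ρ : Matrix (Fin d) (Fin d) ℂ) : Set ℕ :=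
  {N | 1 ≤ N ∧ N ≤ d ∧ ∃ Λ : Matrix (Fin d) (Fin d) ℂ → Matrix (Fin d) (Fin d) ℂ,
    O.Mem Λ ∧ purifiedDist (Λ ρ) (proj (maxCoherent d N)) ≤ ε}

/-- Feasible `N` for one-shot distillation from `ρ` with a perfect pure catalyst
of arbitrary finite dimension. -/
def distillPcSet (O : OpClass) (ε : ℝ) {d : ℕ} (ρ : Matrix (Fin d) (Fin d) ℂ) : Set ℕ :=
  {N | 1 ≤ N ∧ N ≤ d ∧ ∃ (m : ℕ)
    (Λ : Matrix (Fin d × Fin m) (Fin d × Fin m) ℂ → Matrix (Fin d × Fin m) (Fin d × Fin m) ℂ)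
    (ω : EuclideanSpace ℂ (Fin m)) (ρout : Matrix (Fin d) (Fin d) ℂ),
    O.Mem Λ ∧ ‖ω‖ = 1 ∧ IsState ρout ∧
    traceA (Λ (ρ ⊗ₖ proj ω)) = proj ω ∧ traceC (Λ (ρ ⊗ₖ proj ω)) = ρout ∧
    purifiedDist ρout (proj (maxCoherent d N)) ≤ ε}

/-- Feasible `N` for one-shot distillation from `φ` with pure output. -/
def pureDistillSet (O : OpClass) (ε : ℝ) {d : ℕ} (φ : EuclideanSpace ℂ (Fin d)) : Set ℕ :=
  {N | 1 ≤ N ∧ N ≤ d ∧ ∃ (Λ : Matrix (Fin d) (Fin d) ℂ → Matrix (Fin d) (Fin d) ℂ)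
    (φout : EuclideanSpace ℂ (Fin d)),
    O.Mem Λ ∧ ‖φout‖ = 1 ∧ Λ (proj φ) = proj φout ∧
    purifiedDist (proj φout) (proj (maxCoherent d N)) ≤ ε}

/-- Feasible `N` for one-shot distillation from `φ` with pure output and a perfect pure
catalyst of arbitrary finite dimension. -/
def pureDistillPcSet (O : OpClass) (ε : ℝ) {d : ℕ} (φ : EuclideanSpace ℂ (Fin d)) : Set ℕ :=
  {N | 1 ≤ N ∧ N ≤ d ∧ ∃ (m : ℕ)
    (Λ : Matrix (Fin d × Fin m) (Fin d × Fin m) ℂ → Matrix (Fin d × Fin m) (Fin d × Fin m) ℂ)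
    (ω : EuclideanSpace ℂ (Fin m)) (φout : EuclideanSpace ℂ (Fin d)),
    O.Mem Λ ∧ ‖ω‖ = 1 ∧ ‖φout‖ = 1 ∧
    traceA (Λ (proj φ ⊗ₖ proj ω)) = proj ω ∧ traceC (Λ (proj φ ⊗ₖ proj ω)) = proj φout ∧
    purifiedDist (proj φout) (proj (maxCoherent d N)) ≤ ε}

/-- The set of values `log₂ N`, for `N` in `S`. -/
def logSet (S : Set ℕ) : Set ℝ := (fun N : ℕ => Real.logb 2 N) '' S

/-- `C^ε_{O,d}(ρ)`. -/
def C_d (O : OpClass) (ε : ℝ) {d : ℕ} (ρ : Matrix (Fin d) (Fin d) ℂ) : ℝ :=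
  sSup (logSet (distillSet O ε ρ))

/-- `C^ε_{O,pc}(ρ)`. -/
def C_pc (O : OpClass) (ε : ℝ) {d : ℕ} (ρ : Matrix (Fin d) (Fin d) ℂ) : ℝ :=
  sSup (logSet (distillPcSet O ε ρ))

/-- `C̃^ε_{O,d}(φ)`: pure-state smoothing. -/
def Ctilde_d (O : OpClass) (ε : ℝ) {d : ℕ} (φ : EuclideanSpace ℂ (Fin d)) : ℝ :=
  sSup (logSet (pureDistillSet O ε φ))

/-- `C̃^ε_{O,pc}(φ)`: pure-state smoothing. -/
def Ctilde_pc (O : OpClass) (ε : ℝ) {d : ℕ} (φ : EuclideanSpace ℂ (Fin d)) : ℝ :=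
  sSup (logSet (pureDistillPcSet O ε φ))

/-- The number of non-zero coefficients in the incoherent basis. -/
def coherenceRank {d : ℕ} (φ : EuclideanSpace ℂ (Fin d)) : ℕ := Nat.card {i // φ i ≠ 0}

/-- The largest squared modulus of a coefficient. -/
def maxCoeff {d : ℕ} (φ : EuclideanSpace ℂ (Fin d)) : ℝ := ⨆ i, ‖φ i‖ ^ 2

end Coherence

end

/-!
A pure state `φ` can be converted into `χ` by incoherent operations, or equally by strictly
incoherent ones, if and only if the distribution `|φ i|²` is majorized by `|χ i|²`: an incoherent
Kraus operator moves the mass of a set `S` of basis vectors into a set of at most as many, and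
conversely, by Rado's theorem, `|φ i|²` is a mixture of permutations of `|χ i|²`, whose terms give
monomial Kraus operators.

A perfect pure catalyst `ω` forces the output to be a product `χ ⊗ ω`, so catalysis replaces this
condition by `φ ⊗ ω ≺ χ ⊗ ω`. Although this is weaker, it still bounds the largest weight of `φ` by
that of `χ` and the rank of `χ` by that of `φ`. When `χ` is `ε`-close to `Ψ_N`, this yields
`|φ i|² ≤ 1 / N + ε` for all `i`, and also `N ≤ r` as soon as `r (r - 1) ε ≤ 1`. Then
`(1 / N + ε, …, 1 / N + ε, 1 / N - (N - 1) ε)` is a distribution on `N` points which majorizes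
`|φ i|²` and whose squared overlap with `Ψ_N` is at least `1 - 2 (N - 1) ε`, so it can be reached
without a catalyst. For `ε = 0` the only condition left is `N ≤ 1 / φ_max`.
-/

noncomputable section

namespace Coherence

section Majorization

/-- Majorization without sorting: the mass `p` gives to a set is at most the mass `q` gives to
some set of at most the same size. For nonnegative `q` this compares the sums of the `k` largest
entries, for every `k`; equality of the total masses is left to the lemmas that need it. -/
def IsMajorizedBy {ι : Type*} (p q : ι → ℝ) : Prop :=
  ∀ S : Finset ι, ∃ T : Finset ι, T.card ≤ S.card ∧ ∑ i ∈ S, p i ≤ ∑ i ∈ T, q i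

variable {ι κ : Type*} {p q : ι → ℝ}

lemma IsMajorizedBy.refl (p : ι → ℝ) : IsMajorizedBy p p := fun S => ⟨S, le_rfl, le_rfl⟩

lemma IsMajorizedBy.comp_equiv (h : IsMajorizedBy p q) (e g : κ ≃ ι) :
    IsMajorizedBy (p ∘ e) (q ∘ g) := by
  intro S
  obtain ⟨T, hT, hle⟩ := h (S.map e.toEmbedding)
  refine ⟨T.map g.symm.toEmbedding, by simpa using hT, ?_⟩
  simpa [Finset.sum_map] using hle

lemma IsMajorizedBy.exists_le (h : IsMajorizedBy p q) (hq : ∀ i, 0 ≤ q i) (i : ι) :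
    ∃ j, p i ≤ q j := by
  obtain ⟨T, hT, hle⟩ := h {i}
  have : Nonempty ι := ⟨i⟩
  obtain ⟨j, hj⟩ := Finset.card_le_one_iff_subset_singleton.1 (by simpa using hT)
  refine ⟨j, ?_⟩
  simpa using hle.trans (Finset.sum_le_sum_of_subset_of_nonneg hj fun _ _ _ => hq _)

lemma IsMajorizedBy.exists_le_of_mul [Finite κ] {w : κ → ℝ}
    (h : IsMajorizedBy (fun x : ι × κ => p x.1 * w x.2) fun x => q x.1 * w x.2)
    (hq : ∀ i, 0 ≤ q i) (hw : ∀ j, 0 ≤ w j) (hw' : w ≠ 0) (i : ι) : ∃ j, p i ≤ q j := by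
  obtain ⟨l, hl⟩ := Function.ne_iff.1 hw'
  have : Nonempty κ := ⟨l⟩
  obtain ⟨k, hk⟩ := Finite.exists_max w
  have hwk : 0 < w k := ((hw l).lt_of_ne' hl).trans_le (hk l)
  obtain ⟨⟨j, k'⟩, hj⟩ := h.exists_le (fun x => mul_nonneg (hq _) (hw _)) (i, k)
  exact ⟨j, le_of_mul_le_mul_right (hj.trans (mul_le_mul_of_nonneg_left (hk k') (hq j))) hwk⟩

lemma IsMajorizedBy.ncard_support_le [Fintype ι] (h : IsMajorizedBy p q) (hq : ∀ i, 0 ≤ q i)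
    (hsum : ∑ i, p i = ∑ i, q i) : q.support.ncard ≤ p.support.ncard := by
  classical
  obtain ⟨T, hT, hle⟩ := h p.support.toFinset
  have hp : ∑ i ∈ p.support.toFinset, p i = ∑ i, p i :=
    Finset.sum_subset (Finset.subset_univ _) fun i _ hi => by simpa using hi
  have hoff : ∀ i ∈ Tᶜ, q i = 0 := by
    refine (Finset.sum_eq_zero_iff_of_nonneg fun i _ => hq i).1
      (le_antisymm ?_ (Finset.sum_nonneg fun i _ => hq i))
    linarith [Finset.sum_add_sum_compl T q]
  have hsub : q.support ⊆ T := fun i hi => by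
    by_contra hiT
    exact hi (hoff i (Finset.mem_compl.2 hiT))
  calc q.support.ncard ≤ (T : Set ι).ncard := Set.ncard_le_ncard hsub T.finite_toSet
    _ = T.card := Set.ncard_coe_finset T
    _ ≤ p.support.toFinset.card := hT
    _ = p.support.ncard := (Set.ncard_eq_toFinset_card' _).symm

lemma IsMajorizedBy.ncard_support_le_of_mul [Fintype ι] [Finite κ] {w : κ → ℝ}
    (h : IsMajorizedBy (fun x : ι × κ => p x.1 * w x.2) fun x => q x.1 * w x.2)
    (hq : ∀ i, 0 ≤ q i) (hw : ∀ j, 0 ≤ w j) (hw' : w ≠ 0) (hsum : ∑ i, p i = ∑ i, q i) :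
    q.support.ncard ≤ p.support.ncard := by
  have := Fintype.ofFinite κ
  have hsupport : ∀ v : ι → ℝ,
      (Function.support fun x : ι × κ => v x.1 * w x.2) = v.support ×ˢ w.support := fun v => by
    ext
    simp
  have hle := h.ncard_support_le (fun x => mul_nonneg (hq _) (hw _)) (by
    simp only [Fintype.sum_prod_type, ← Finset.mul_sum, ← Finset.sum_mul, hsum])
  rw [hsupport, hsupport, Set.ncard_prod, Set.ncard_prod] at hle
  refine Nat.le_of_mul_le_mul_right hle ((Set.ncard_pos (Set.toFinite _)).2 ?_)
  exact Function.support_nonempty_iff.2 hw'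

lemma isMajorizedBy_of_forall_le [Fintype ι] {F G : Finset ι} {c : ℝ} (hp : ∀ i, 0 ≤ p i)
    (hpc : ∀ i, p i ≤ c) (hqc : ∀ i ∈ F, c ≤ q i) (hG : G.card ≤ F.card + 1)
    (hsum : ∑ i, p i ≤ ∑ i ∈ G, q i) : IsMajorizedBy p q := by
  intro S
  obtain hS | hS := le_or_gt S.card F.card
  · obtain ⟨T, hTF, hT⟩ := Finset.exists_subset_card_eq hS
    refine ⟨T, hT.le, ?_⟩
    calc ∑ i ∈ S, p i ≤ S.card • c := Finset.sum_le_card_nsmul _ _ _ fun i _ => hpc i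
      _ = T.card • c := by rw [hT]
      _ ≤ ∑ i ∈ T, q i := Finset.card_nsmul_le_sum _ _ _ fun i hi => hqc i (hTF hi)
  · exact ⟨G, hG.trans hS, (Finset.sum_le_univ_sum_of_nonneg hp).trans hsum⟩

lemma sum_le_sum_of_card_le_of_forall_notMem_le {F T : Finset ι} (hq : ∀ i, 0 ≤ q i)
    (hF : ∀ i ∈ F, ∀ j ∉ F, q j ≤ q i) (hT : T.card ≤ F.card) :
    ∑ i ∈ T, q i ≤ ∑ i ∈ F, q i := by
  classical
  rw [← Finset.sum_sdiff_le_sum_sdiff]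
  obtain hempty | hne := (T \ F).eq_empty_or_nonempty
  · rw [hempty, Finset.sum_empty]
    exact Finset.sum_nonneg fun i _ => hq i
  obtain ⟨m, hm, hmax⟩ := Finset.exists_max_image (T \ F) q hne
  calc ∑ i ∈ T \ F, q i ≤ (T \ F).card • q m := Finset.sum_le_card_nsmul _ _ _ hmax
    _ ≤ (F \ T).card • q m :=
      nsmul_le_nsmul_left (hq m) (Finset.card_sdiff_le_card_sdiff_iff.2 hT)
    _ ≤ ∑ i ∈ F \ T, q i := Finset.card_nsmul_le_sum _ _ _ fun i hi =>
      hF i (Finset.mem_sdiff.1 hi).1 m (Finset.mem_sdiff.1 hm).2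

lemma mul_sum_le_sum_mul_of_antitone {α : Type*} [LinearOrder α] {y a : α → ℝ} (hy : Antitone y)
    {s : Finset α} {c : ℝ} (hc : ∀ i ∈ s, c ≤ y i) (ha : ∀ i ∈ s, 0 ≤ ∑ j ∈ s with j ≤ i, a j) :
    c * ∑ i ∈ s, a i ≤ ∑ i ∈ s, y i * a i := by
  induction s using Finset.induction_on_max generalizing c with
  | empty => simp
  | insert m s hm ih =>
    have hms : m ∉ s := fun h => lt_irrefl m (hm m h)
    have hprefix : ∀ i ∈ s, 0 ≤ ∑ j ∈ s with j ≤ i, a j := fun i hi => by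
      have := ha i (Finset.mem_insert_of_mem hi)
      rwa [Finset.filter_insert, if_neg (hm i hi).not_ge] at this
    have htotal : 0 ≤ ∑ j ∈ insert m s, a j := by
      have := ha m (Finset.mem_insert_self m s)
      rwa [Finset.filter_true_of_mem] at this
      simpa using fun j hj => (hm j hj).le
    calc c * ∑ j ∈ insert m s, a j ≤ y m * ∑ j ∈ insert m s, a j :=
          mul_le_mul_of_nonneg_right (hc m (Finset.mem_insert_self m s)) htotal
      _ = y m * a m + y m * ∑ j ∈ s, a j := by rw [Finset.sum_insert hms, mul_add]
      _ ≤ y m * a m + ∑ j ∈ s, y j * a j := by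
          gcongr
          exact ih (fun i hi => hy (hm i hi).le) hprefix
      _ = ∑ j ∈ insert m s, y j * a j := by rw [Finset.sum_insert hms]

lemma IsMajorizedBy.sum_mul_le_sum_mul_of_antitone {α : Type*} [LinearOrder α] [Fintype α]
    {p q y : α → ℝ} (h : IsMajorizedBy p q) (hq : ∀ i, 0 ≤ q i) (hsum : ∑ i, p i = ∑ i, q i)
    (hqa : Antitone q) (hy : Antitone y) : ∑ i, y i * p i ≤ ∑ i, y i * q i := by
  obtain ⟨c, hc⟩ := (Set.finite_range y).bddBelow
  have hprefix : ∀ i ∈ Finset.univ, 0 ≤ ∑ j with j ≤ i, (q j - p j) := fun i _ => by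
    obtain ⟨T, hT, hle⟩ := h {j | j ≤ i}
    rw [Finset.sum_sub_distrib, sub_nonneg]
    refine hle.trans (sum_le_sum_of_card_le_of_forall_notMem_le hq (fun j hj k hk => ?_) hT)
    simp only [Finset.mem_filter_univ, not_le] at hj hk
    exact hqa (hj.trans hk.le)
  have habel := mul_sum_le_sum_mul_of_antitone hy (c := c) (fun i _ => hc ⟨i, rfl⟩) hprefix
  simpa [mul_sub, Finset.sum_sub_distrib, hsum] using habel

lemma exists_equiv_fin_antitone [Fintype ι] (y : ι → ℝ) :
    ∃ e : Fin (Fintype.card ι) ≃ ι, Antitone (y ∘ e) := by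
  let e := (Fintype.equivFin ι).symm
  refine ⟨(Tuple.sort fun i => - y (e i)).trans e, fun i j hij => ?_⟩
  simpa using Tuple.monotone_sort (fun i => - y (e i)) hij

lemma IsMajorizedBy.exists_perm_sum_mul_le [Fintype ι] (h : IsMajorizedBy p q)
    (hq : ∀ i, 0 ≤ q i) (hsum : ∑ i, p i = ∑ i, q i) (y : ι → ℝ) :
    ∃ π : Equiv.Perm ι, ∑ i, y i * p i ≤ ∑ i, y i * q (π i) := by
  obtain ⟨e, he⟩ := exists_equiv_fin_antitone y
  obtain ⟨g, hg⟩ := exists_equiv_fin_antitone q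
  refine ⟨e.symm.trans g, ?_⟩
  rw [← e.sum_comp fun i => y i * p i, ← e.sum_comp fun i => y i * q _]
  have hsorted := (h.comp_equiv e g).sum_mul_le_sum_mul_of_antitone (fun i => hq _)
    (by simpa only [Function.comp_apply, e.sum_comp p, g.sum_comp q] using hsum) hg he
  simpa only [Equiv.trans_apply, Equiv.symm_apply_apply, Function.comp_apply] using hsorted

-- Rado's theorem: a separating functional would contradict the rearrangement inequality.
theorem IsMajorizedBy.mem_convexHull [Fintype ι] (h : IsMajorizedBy p q)
    (hq : ∀ i, 0 ≤ q i) (hsum : ∑ i, p i = ∑ i, q i) :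
    p ∈ convexHull ℝ (Set.range fun π : Equiv.Perm ι => q ∘ π) := by
  classical
  by_contra hp
  obtain ⟨f, u, hfu, hup⟩ := geometric_hahn_banach_closed_point (convex_convexHull ℝ _)
    ((Set.finite_range _).isClosed_convexHull ℝ) hp
  have hf : ∀ v : ι → ℝ, f v = ∑ i, f (Pi.single i 1) * v i := fun v => by
    conv_lhs => rw [pi_eq_sum_univ' v, map_sum]
    exact Finset.sum_congr rfl fun i _ => by rw [map_smul, smul_eq_mul, mul_comm]
  obtain ⟨π, hπ⟩ := h.exists_perm_sum_mul_le hq hsum fun i => f (Pi.single i 1)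
  refine (hup.trans_le ?_).not_gt (hfu (q ∘ π) (subset_convexHull ℝ _ ⟨π, rfl⟩))
  rw [hf p, hf (q ∘ π)]
  exact hπ

lemma IsMajorizedBy.exists_weights [Fintype ι] (h : IsMajorizedBy p q)
    (hq : ∀ i, 0 ≤ q i) (hsum : ∑ i, p i = ∑ i, q i) :
    ∃ (k : ℕ) (w : Fin k → ℝ) (π : Fin k → Equiv.Perm ι), (∀ n, 0 ≤ w n) ∧ ∑ n, w n = 1 ∧
      ∀ i, ∑ n, w n * q (π n i) = p i := by
  obtain ⟨κ, _, w, z, hw0, hw1, hz, rfl⟩ :=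
    mem_convexHull_iff_exists_fintype.1 (h.mem_convexHull hq hsum)
  choose π hπ using hz
  let e := (Fintype.equivFin κ).symm
  refine ⟨Fintype.card κ, w ∘ e, π ∘ e, fun n => hw0 _, (e.sum_comp w).trans hw1, fun i => ?_⟩
  rw [Finset.sum_apply]
  refine (e.sum_comp fun n => w n * q (π n i)).trans (Finset.sum_congr rfl fun n _ => ?_)
  rw [← hπ n]
  rfl

end Majorization

section PureStates

lemma exists_eq_smul_of_sum_norm_sq_le {𝕜 E κ : Type*} [RCLike 𝕜] [NormedAddCommGroup E]
    [InnerProductSpace 𝕜 E] [Fintype κ] {ψ : E} (hψ : ‖ψ‖ = 1) {v : κ → E}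
    (h : ∑ n, ‖v n‖ ^ 2 ≤ ∑ n, ‖inner 𝕜 ψ (v n)‖ ^ 2) (n : κ) : ∃ c : 𝕜, v n = c • ψ := by
  have hle : ∀ n ∈ Finset.univ, ‖inner 𝕜 ψ (v n)‖ ^ 2 ≤ ‖v n‖ ^ 2 := fun n _ => by
    gcongr
    simpa [hψ] using norm_inner_le_norm (𝕜 := 𝕜) ψ (v n)
  have heq := (Finset.sum_eq_sum_iff_of_le hle).1 ((Finset.sum_le_sum hle).antisymm h)
    n (Finset.mem_univ n)
  have hcs : ‖inner 𝕜 ψ (v n)‖ = ‖ψ‖ * ‖v n‖ := by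
    rw [hψ, one_mul]
    exact (pow_left_inj₀ (norm_nonneg _) (norm_nonneg _) two_ne_zero).1 heq
  have hspan : ψ = 0 ∨ ∃ c : 𝕜, v n = c • ψ :=
    ((norm_inner_eq_norm_tfae 𝕜 ψ (v n)).out 0 2).1 hcs
  refine hspan.resolve_left ?_
  rintro rfl
  simp at hψ

variable {ι : Type}

/-- The probability distribution of the outcome when `ψ` is measured in the incoherent basis. -/
def coeffDist (ψ : EuclideanSpace ℂ ι) (i : ι) : ℝ := ‖ψ i‖ ^ 2

lemma coeffDist_nonneg (ψ : EuclideanSpace ℂ ι) (i : ι) : 0 ≤ coeffDist ψ i := sq_nonneg _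

variable [Fintype ι]

lemma sum_coeffDist (ψ : EuclideanSpace ℂ ι) : ∑ i, coeffDist ψ i = ‖ψ‖ ^ 2 :=
  (EuclideanSpace.norm_sq_eq ψ).symm

lemma sum_coeffDist_eq_one_iff {ψ : EuclideanSpace ℂ ι} :
    ∑ i, coeffDist ψ i = 1 ↔ ‖ψ‖ = 1 := by
  rw [sum_coeffDist, pow_eq_one_iff_of_nonneg (norm_nonneg ψ) two_ne_zero]

lemma coeffDist_ne_zero {ψ : EuclideanSpace ℂ ι} (hψ : ‖ψ‖ = 1) : coeffDist ψ ≠ 0 := by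
  intro h
  simpa [h] using sum_coeffDist_eq_one_iff.2 hψ

lemma norm_inner_le_sum (ψ χ : EuclideanSpace ℂ ι) :
    ‖inner ℂ ψ χ‖ ≤ ∑ i, ‖ψ i‖ * ‖χ i‖ := by
  rw [PiLp.inner_apply]
  exact (norm_sum_le _ _).trans (Finset.sum_le_sum fun i _ => norm_inner_le_norm _ _)

lemma proj_eq_vecMulVec (ψ : EuclideanSpace ℂ ι) : proj ψ = Matrix.vecMulVec ψ (star ψ.ofLp) := rfl

lemma proj_smul (c : ℂ) (ψ : EuclideanSpace ℂ ι) : proj (c • ψ) = (c * star c) • proj ψ := by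
  simp [proj_eq_vecMulVec, Matrix.smul_vecMulVec, Matrix.vecMulVec_smul, smul_smul, mul_comm]

lemma trace_proj (ψ : EuclideanSpace ℂ ι) : (proj ψ).trace = ((‖ψ‖ ^ 2 : ℝ) : ℂ) := by
  rw [proj_eq_vecMulVec, Matrix.trace_vecMulVec, ← EuclideanSpace.inner_eq_star_dotProduct,
    inner_self_eq_norm_sq_to_K]
  norm_cast

lemma posSemidef_proj (ψ : EuclideanSpace ℂ ι) : (proj ψ).PosSemidef :=
  Matrix.posSemidef_vecMulVec_self_star ψ.ofLp

lemma isState_proj {ψ : EuclideanSpace ℂ ι} (hψ : ‖ψ‖ = 1) : IsState (proj ψ) :=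
  ⟨posSemidef_proj ψ, by simp [trace_proj, hψ]⟩

lemma mul_proj_mul_conjTranspose {κ : Type} [Fintype κ] (K : Matrix κ ι ℂ)
    (ψ : EuclideanSpace ℂ ι) :
    K * proj ψ * K.conjTranspose = proj (WithLp.toLp 2 (K.mulVec ψ)) := by
  simp only [proj_eq_vecMulVec, Matrix.mul_vecMulVec, Matrix.vecMulVec_mul, Matrix.star_mulVec]

lemma proj_mul_proj (ψ χ : EuclideanSpace ℂ ι) :
    proj ψ * proj χ = inner ℂ ψ χ • Matrix.vecMulVec ψ (star χ.ofLp) := by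
  rw [proj_eq_vecMulVec, proj_eq_vecMulVec, Matrix.vecMulVec_mul_vecMulVec,
    Matrix.vecMulVec_smul, EuclideanSpace.inner_eq_star_dotProduct, dotProduct_comm]

lemma trace_proj_mul_proj (ψ χ : EuclideanSpace ℂ ι) :
    (proj ψ * proj χ).trace = ((‖inner ℂ ψ χ‖ ^ 2 : ℝ) : ℂ) := by
  rw [proj_mul_proj, Matrix.trace_smul, Matrix.trace_vecMulVec,
    ← EuclideanSpace.inner_eq_star_dotProduct, ← inner_conj_symm χ ψ, smul_eq_mul,
    Complex.mul_conj']
  norm_cast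

lemma exists_eq_sum_proj {X : Matrix ι ι ℂ} (hX : X.PosSemidef) :
    ∃ (k : ℕ) (v : Fin k → EuclideanSpace ℂ ι), X = ∑ n, proj (v n) := by
  obtain ⟨k, v, hv⟩ := Matrix.posSemidef_iff_eq_sum_vecMulVec.1 hX
  exact ⟨k, fun n => WithLp.toLp 2 (v n), hv⟩

lemma exists_eq_smul_of_trace_le {κ : Type*} [Fintype κ] {v : κ → EuclideanSpace ℂ ι}
    {ψ : EuclideanSpace ℂ ι} (hψ : ‖ψ‖ = 1)
    (h : (∑ n, proj (v n)).trace.re ≤ (proj ψ * ∑ n, proj (v n)).trace.re) (n : κ) :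
    ∃ c : ℂ, v n = c • ψ := by
  refine exists_eq_smul_of_sum_norm_sq_le hψ ?_ n
  simpa only [Finset.mul_sum, Matrix.trace_sum, trace_proj, trace_proj_mul_proj, Complex.re_sum,
    Complex.ofReal_re] using h

lemma exists_eq_smul_of_sum_proj_eq {κ : Type*} [Fintype κ] {v : κ → EuclideanSpace ℂ ι}
    {ψ : EuclideanSpace ℂ ι} (hψ : ‖ψ‖ = 1) (h : ∑ n, proj (v n) = proj ψ) (n : κ) :
    ∃ c : ℂ, v n = c • ψ := by
  refine exists_eq_smul_of_trace_le hψ ?_ n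
  simp [h, trace_proj, trace_proj_mul_proj, hψ]

lemma sum_proj_eq_of_forall_eq_smul {κ : Type*} [Fintype κ] {v : κ → EuclideanSpace ℂ ι}
    {ψ : EuclideanSpace ℂ ι} (hψ : ‖ψ‖ = 1) (h : ∀ n, ∃ c : ℂ, v n = c • ψ)
    (htr : (∑ n, proj (v n)).trace = 1) : ∑ n, proj (v n) = proj ψ := by
  choose c hc using h
  have hsmul : ∑ n, proj (v n) = (∑ n, c n * star (c n)) • proj ψ := by
    simp only [hc, proj_smul, Finset.sum_smul]
  rw [hsmul, Matrix.trace_smul, (isState_proj hψ).2, smul_eq_mul, mul_one] at htr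
  rw [hsmul, htr, one_smul]

lemma IsState.eq_proj_of_one_le_trace {ρ : Matrix ι ι ℂ} (hρ : IsState ρ)
    {ψ : EuclideanSpace ℂ ι} (hψ : ‖ψ‖ = 1) (h : 1 ≤ (proj ψ * ρ).trace.re) : ρ = proj ψ := by
  obtain ⟨k, v, rfl⟩ := exists_eq_sum_proj hρ.1
  refine sum_proj_eq_of_forall_eq_smul hψ (exists_eq_smul_of_trace_le hψ ?_) hρ.2
  rwa [hρ.2, Complex.one_re]

end PureStates

section Fidelity

variable {ι : Type} [Fintype ι]

open scoped Classical in
lemma sqrt_proj (ψ : EuclideanSpace ℂ ι) :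
    CFC.sqrt (proj ψ) = ((‖ψ‖⁻¹ : ℝ) : ℂ) • proj ψ := by
  refine CFC.sqrt_unique ?_ ?_
  · obtain rfl | hψ := eq_or_ne ψ 0
    · simp [proj_eq_vecMulVec]
    have hψ' : (‖ψ‖ : ℂ) ≠ 0 := by simpa using hψ
    rw [smul_mul_smul_comm, proj_mul_proj, inner_self_eq_norm_sq_to_K, ← proj_eq_vecMulVec,
      smul_smul]
    convert one_smul ℂ (proj ψ) using 2
    push_cast
    field_simp
    rfl
  · rw [Matrix.nonneg_iff_posSemidef]
    exact (posSemidef_proj ψ).smul (by exact_mod_cast inv_nonneg.2 (norm_nonneg ψ))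

open scoped Classical in
lemma trace_sqrt_proj (ψ : EuclideanSpace ℂ ι) : (CFC.sqrt (proj ψ)).trace = ‖ψ‖ := by
  rw [sqrt_proj, Matrix.trace_smul, trace_proj, smul_eq_mul]
  obtain h | h := eq_or_ne ‖ψ‖ 0
  · simp [h]
  · norm_cast
    field_simp

variable [DecidableEq ι]

lemma fidelity_proj_sq {ρ : Matrix ι ι ℂ} (hρ : ρ.PosSemidef) (ψ : EuclideanSpace ℂ ι) :
    fidelity ρ (proj ψ) ^ 2 = (proj ψ * ρ).trace.re := by
  have hB : (CFC.sqrt ρ).conjTranspose = CFC.sqrt ρ :=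
    (Matrix.nonneg_iff_posSemidef.1 (CFC.sqrt_nonneg ρ)).isHermitian
  have hpure := mul_proj_mul_conjTranspose (CFC.sqrt ρ) ψ
  rw [hB] at hpure
  have htrace := congrArg Matrix.trace hpure
  rw [Matrix.trace_mul_comm, ← mul_assoc, CFC.sqrt_mul_sqrt_self ρ hρ.nonneg,
    Matrix.trace_mul_comm, trace_proj] at htrace
  rw [fidelity, hpure, trace_sqrt_proj, htrace, Complex.ofReal_re, Complex.ofReal_re]

lemma purifiedDist_le_one (ρ σ : Matrix ι ι ℂ) : purifiedDist ρ σ ≤ 1 :=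
  Real.sqrt_le_one.2 (sub_le_self 1 (sq_nonneg _))

lemma purifiedDist_proj_proj_le_iff {ε : ℝ} (hε : 0 ≤ ε) (χ ψ : EuclideanSpace ℂ ι) :
    purifiedDist (proj χ) (proj ψ) ≤ ε ↔ 1 - ‖inner ℂ ψ χ‖ ^ 2 ≤ ε ^ 2 := by
  rw [purifiedDist, fidelity_proj_sq (posSemidef_proj χ), trace_proj_mul_proj, Complex.ofReal_re,
    Real.sqrt_le_left hε]

lemma IsState.eq_proj_of_purifiedDist_le_zero {ρ : Matrix ι ι ℂ} (hρ : IsState ρ)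
    {ψ : EuclideanSpace ℂ ι} (hψ : ‖ψ‖ = 1) (h : purifiedDist ρ (proj ψ) ≤ 0) : ρ = proj ψ := by
  rw [purifiedDist, Real.sqrt_le_left le_rfl, fidelity_proj_sq hρ.1] at h
  exact hρ.eq_proj_of_one_le_trace hψ (by linarith)

end Fidelity

section Overlap

variable {ι : Type} [Fintype ι]

-- With `x = sin s` and `a = sin t`, the hypothesis says `|sin (s - t)| ≤ ε` and the conclusion
-- follows from `sin² s - sin² t = sin (s - t) * sin (s + t)`.
lemma sq_le_sq_add_of_one_sub_sq_le {x y a b ε : ℝ} (hxy : x ^ 2 + y ^ 2 = 1)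
    (hab : a ^ 2 + b ^ 2 = 1) (hε : 0 ≤ ε) (h : 1 - (a * x + b * y) ^ 2 ≤ ε ^ 2) :
    x ^ 2 ≤ a ^ 2 + ε := by
  have hdiff : |x * b - y * a| ≤ ε := abs_le_of_sq_le_sq (by nlinarith) hε
  have hsum : |x * b + y * a| ≤ 1 :=
    abs_le_of_sq_le_sq (by nlinarith [sq_nonneg (x * a - y * b)]) zero_le_one
  have hprod : x ^ 2 - a ^ 2 = (x * b - y * a) * (x * b + y * a) := by
    linear_combination a ^ 2 * hxy - x ^ 2 * hab
  have hle : (x * b - y * a) * (x * b + y * a) ≤ ε * 1 :=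
    (le_abs_self _).trans ((abs_mul _ _).trans_le (mul_le_mul hdiff hsum (abs_nonneg _) hε))
  linarith

lemma sum_coeffDist_le_add {χ ψ : EuclideanSpace ℂ ι} (hχ : ‖χ‖ = 1) (hψ : ‖ψ‖ = 1) {ε : ℝ}
    (hε : 0 ≤ ε) (h : 1 - ‖inner ℂ ψ χ‖ ^ 2 ≤ ε ^ 2) (S : Finset ι) :
    ∑ i ∈ S, coeffDist χ i ≤ ∑ i ∈ S, coeffDist ψ i + ε := by
  classical
  have hsq : ∀ (θ : EuclideanSpace ℂ ι) (T : Finset ι),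
      √(∑ i ∈ T, ‖θ i‖ ^ 2) ^ 2 = ∑ i ∈ T, coeffDist θ i := fun θ T =>
    Real.sq_sqrt (Finset.sum_nonneg fun i _ => sq_nonneg _)
  have hunit : ∀ θ : EuclideanSpace ℂ ι, ‖θ‖ = 1 →
      √(∑ i ∈ S, ‖θ i‖ ^ 2) ^ 2 + √(∑ i ∈ Sᶜ, ‖θ i‖ ^ 2) ^ 2 = 1 := fun θ hθ => by
    rw [hsq, hsq, Finset.sum_add_sum_compl, sum_coeffDist_eq_one_iff.2 hθ]
  have hinner : ‖inner ℂ ψ χ‖ ≤ √(∑ i ∈ S, ‖ψ i‖ ^ 2) * √(∑ i ∈ S, ‖χ i‖ ^ 2) +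
      √(∑ i ∈ Sᶜ, ‖ψ i‖ ^ 2) * √(∑ i ∈ Sᶜ, ‖χ i‖ ^ 2) := by
    refine (norm_inner_le_sum ψ χ).trans ?_
    rw [← Finset.sum_add_sum_compl S]
    exact add_le_add (Real.sum_mul_le_sqrt_mul_sqrt _ _ _) (Real.sum_mul_le_sqrt_mul_sqrt _ _ _)
  rw [← hsq, ← hsq]
  refine sq_le_sq_add_of_one_sub_sq_le (hunit χ hχ) (hunit ψ hψ) hε (le_trans ?_ h)
  gcongr

lemma norm_inner_sq_le_sum_coeffDist {χ ψ : EuclideanSpace ℂ ι} (hχ : ‖χ‖ = 1) {S : Finset ι}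
    (hS : ∀ i ∉ S, χ i = 0) : ‖inner ℂ ψ χ‖ ^ 2 ≤ ∑ i ∈ S, coeffDist ψ i := by
  have hsum : ∑ i, ‖ψ i‖ * ‖χ i‖ = ∑ i ∈ S, ‖ψ i‖ * ‖χ i‖ :=
    (Finset.sum_subset (Finset.subset_univ S) fun i _ hi => by simp [hS i hi]).symm
  calc ‖inner ℂ ψ χ‖ ^ 2 ≤ (∑ i ∈ S, ‖ψ i‖ * ‖χ i‖) ^ 2 := by
        gcongr
        exact hsum ▸ norm_inner_le_sum ψ χ
    _ ≤ (∑ i ∈ S, coeffDist ψ i) * ∑ i ∈ S, coeffDist χ i := Finset.sum_mul_sq_le_sq_mul_sq _ _ _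
    _ ≤ (∑ i ∈ S, coeffDist ψ i) * 1 := by
        refine mul_le_mul_of_nonneg_left ?_ (Finset.sum_nonneg fun i _ => coeffDist_nonneg ψ i)
        rw [← sum_coeffDist_eq_one_iff.2 hχ]
        exact Finset.sum_le_univ_sum_of_nonneg (coeffDist_nonneg χ)
    _ = ∑ i ∈ S, coeffDist ψ i := mul_one _

end Overlap

section IncoherentPreserving

variable {ι : Type} [Fintype ι]

lemma isState_inv_trace_smul {X : Matrix ι ι ℂ} (hX : X.PosSemidef) (htr : X.trace ≠ 0) :
    IsState (X.trace⁻¹ • X) :=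
  ⟨hX.smul (inv_nonneg.2 hX.trace_nonneg), by
    rw [Matrix.trace_smul, smul_eq_mul, inv_mul_cancel₀ htr]⟩

variable [DecidableEq ι]

lemma isIncoherentState_iff {δ : Matrix ι ι ℂ} :
    IsIncoherentState δ ↔ IsState δ ∧ δ.IsDiag := by
  constructor
  · rintro ⟨p, hp, hsum, rfl⟩
    refine ⟨⟨Matrix.PosSemidef.diagonal fun i => by simpa using hp i, ?_⟩,
      Matrix.isDiag_diagonal _⟩
    rw [Matrix.trace_diagonal]
    exact_mod_cast hsum
  · rintro ⟨⟨hpos, htr⟩, hdiag⟩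
    have hre : ∀ i, ((δ i i).re : ℂ) = δ i i := fun i =>
      (Complex.eq_re_of_ofReal_le (r := 0) (by simpa using hpos.diag_nonneg)).symm
    refine ⟨fun i => (δ i i).re, fun i => (Complex.le_def.1 hpos.diag_nonneg).1, ?_, ?_⟩
    · simpa [Matrix.trace] using congrArg Complex.re htr
    · simp only [hre]
      exact hdiag.diagonal_diag.symm

lemma isDiag_proj_single (j : ι) : (proj (EuclideanSpace.single j 1)).IsDiag := by
  intro i i' hne
  rw [proj_eq_vecMulVec, Matrix.vecMulVec_apply]
  obtain h | h : i ≠ j ∨ i' ≠ j := by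
    by_contra! h
    exact hne (h.1.trans h.2.symm)
  all_goals simp [h]

lemma IsIncoherentPreserving.exists_forall_eq {K : Matrix ι ι ℂ} (hK : IsIncoherentPreserving K)
    (j : ι) : ∃ i, ∀ i', K i' j ≠ 0 → i' = i := by
  by_cases h0 : ∃ i, K i j ≠ 0
  swap
  · exact ⟨j, fun i hi => (h0 ⟨i, hi⟩).elim⟩
  obtain ⟨i, hi⟩ := h0
  have himage : K * proj (EuclideanSpace.single j 1) * K.conjTranspose =
      proj (WithLp.toLp 2 fun l => K l j) := by
    rw [mul_proj_mul_conjTranspose]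
    congr 2
    ext l
    simp
  have htr : (K * proj (EuclideanSpace.single j 1) * K.conjTranspose).trace ≠ 0 := by
    rw [himage, trace_proj, Complex.ofReal_ne_zero]
    refine pow_ne_zero 2 (norm_ne_zero_iff.2 fun h => hi ?_)
    exact congrArg (fun u : EuclideanSpace ℂ ι => u i) h
  have hdiag := (isIncoherentState_iff.1 (hK _ (isIncoherentState_iff.2
    ⟨isState_proj (by simp), isDiag_proj_single j⟩) htr)).2
  refine ⟨i, fun i' hi' => by_contra fun hne => ?_⟩
  have hentry : (K * proj (EuclideanSpace.single j 1) * K.conjTranspose) i' i = 0 :=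
    (mul_eq_zero.1 (hdiag hne)).resolve_left (inv_ne_zero htr)
  rw [himage] at hentry
  exact mul_ne_zero hi' (star_ne_zero.2 hi) hentry

theorem isIncoherentPreserving_iff {K : Matrix ι ι ℂ} :
    IsIncoherentPreserving K ↔ ∃ f : ι → ι, ∀ i j, K i j ≠ 0 → i = f j := by
  constructor
  · intro hK
    choose f hf using hK.exists_forall_eq
    exact ⟨f, fun i j => hf j i⟩
  · rintro ⟨f, hf⟩ δ hδ htr
    obtain ⟨⟨hpos, -⟩, hdiag⟩ := isIncoherentState_iff.1 hδ
    refine isIncoherentState_iff.2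
      ⟨isState_inv_trace_smul (hpos.mul_mul_conjTranspose_same K) htr, Matrix.IsDiag.smul _ ?_⟩
    intro i i' hne
    rw [← hdiag.diagonal_diag, Matrix.mul_apply]
    refine Finset.sum_eq_zero fun j _ => ?_
    obtain h | h : K i j = 0 ∨ K i' j = 0 := by
      by_contra! h
      exact hne ((hf i j h.1).trans (hf i' j h.2).symm)
    all_goals simp [h]

end IncoherentPreserving

section Necessity

variable {ι κ μ : Type} [Fintype ι] [Fintype κ] [Fintype μ]

lemma sum_inner_mulVec [DecidableEq ι] {K : κ → Matrix μ ι ℂ}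
    (hK : ∑ n, (K n).conjTranspose * K n = 1) (x y : EuclideanSpace ℂ ι) :
    ∑ n, inner ℂ (WithLp.toLp 2 ((K n).mulVec x)) (WithLp.toLp 2 ((K n).mulVec y)) =
      inner ℂ x y := by
  have hinner : ∀ n, inner ℂ (WithLp.toLp 2 ((K n).mulVec x)) (WithLp.toLp 2 ((K n).mulVec y)) =
      star x.ofLp ⬝ᵥ ((K n).conjTranspose * K n).mulVec y := fun n => by
    rw [EuclideanSpace.inner_toLp_toLp, dotProduct_comm, Matrix.star_mulVec,
      ← Matrix.mulVec_mulVec, Matrix.dotProduct_mulVec (star x.ofLp)]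
  simp only [hinner]
  rw [← dotProduct_sum, ← Matrix.sum_mulVec, hK, Matrix.one_mulVec, dotProduct_comm,
    EuclideanSpace.inner_eq_star_dotProduct]

lemma sum_norm_sq_mulVec [DecidableEq ι] {K : κ → Matrix μ ι ℂ}
    (hK : ∑ n, (K n).conjTranspose * K n = 1) (x : EuclideanSpace ℂ ι) :
    ∑ n, ‖WithLp.toLp 2 ((K n).mulVec x)‖ ^ 2 = ‖x‖ ^ 2 := by
  have h := congrArg Complex.re (sum_inner_mulVec hK x x)
  simp only [inner_self_eq_norm_sq_to_K, Complex.re_sum] at h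
  exact_mod_cast h

lemma two_mul_re_inner_le {u : EuclideanSpace ℂ ι} {T : Finset ι} (hu : ∀ i ∉ T, u i = 0)
    (v : EuclideanSpace ℂ ι) :
    2 * (inner ℂ u v).re ≤ ‖u‖ ^ 2 + ∑ i ∈ T, coeffDist v i := by
  have hT : ∀ f : ι → ℝ, (∀ i, u i = 0 → f i = 0) → ∑ i, f i = ∑ i ∈ T, f i := fun f hf =>
    (Finset.sum_subset (Finset.subset_univ T) fun i _ hi => hf i (hu i hi)).symm
  rw [PiLp.inner_apply, Complex.re_sum, hT _ (fun i hi => by simp [hi]), ← sum_coeffDist,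
    hT _ (fun i hi => by simp [coeffDist, hi]), Finset.mul_sum, ← Finset.sum_add_distrib]
  refine Finset.sum_le_sum fun i _ => ?_
  have hcs : (inner ℂ (u i) (v i)).re ≤ ‖u i‖ * ‖v i‖ :=
    (Complex.re_le_norm _).trans (norm_inner_le_norm _ _)
  simp only [coeffDist]
  linarith [two_mul_le_add_sq ‖u i‖ ‖v i‖]

-- Let `x` be the restriction of `φ` to `S`. Then `‖x‖² = ⟪x, φ⟫ = ∑ n, ⟪K n x, K n φ⟫`, and
-- `K n x` is supported on the image of `S` under `f n`.
lemma sum_coeffDist_le_sum_image [DecidableEq ι] [DecidableEq μ] {K : κ → Matrix μ ι ℂ}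
    (hK : ∑ n, (K n).conjTranspose * K n = 1) {f : κ → ι → μ}
    (hf : ∀ n i j, K n i j ≠ 0 → i = f n j) (φ : EuclideanSpace ℂ ι) (S : Finset ι) :
    ∑ j ∈ S, coeffDist φ j ≤
      ∑ n, ∑ i ∈ S.image (f n), coeffDist (WithLp.toLp 2 ((K n).mulVec φ)) i := by
  let x : EuclideanSpace ℂ ι := WithLp.toLp 2 fun j => if j ∈ S then φ j else 0
  have hxnorm : ‖x‖ ^ 2 = ∑ j ∈ S, coeffDist φ j := by
    simp [← sum_coeffDist, coeffDist, x, apply_ite, Finset.sum_ite_mem]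
  have hxinner : (inner ℂ x φ).re = ‖x‖ ^ 2 := by
    rw [← inner_self_eq_norm_sq (𝕜 := ℂ) x]
    refine congrArg Complex.re ?_
    simp only [PiLp.inner_apply]
    exact Finset.sum_congr rfl fun j _ => by by_cases hj : j ∈ S <;> simp [x, hj]
  have hsupport : ∀ n, ∀ i ∉ S.image (f n), (K n).mulVec x i = 0 := fun n i hi => by
    refine Finset.sum_eq_zero fun j _ => mul_eq_zero.2 ?_
    by_contra! h
    have hj : j ∈ S := by
      by_contra hj
      exact h.2 (if_neg hj)
    exact hi (Finset.mem_image.2 ⟨j, hj, (hf n i j h.1).symm⟩)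
  have hsum := Finset.sum_le_sum fun n (_ : n ∈ Finset.univ) =>
    two_mul_re_inner_le (u := WithLp.toLp 2 ((K n).mulVec x)) (hsupport n)
      (WithLp.toLp 2 ((K n).mulVec φ))
  rw [← Finset.mul_sum, ← Complex.re_sum, sum_inner_mulVec hK, hxinner, Finset.sum_add_distrib,
    sum_norm_sq_mulVec hK] at hsum
  linarith

theorem isMajorizedBy_of_kraus [DecidableEq ι] {K : κ → Matrix ι ι ℂ}
    (hK : ∑ n, (K n).conjTranspose * K n = 1) (hinc : ∀ n, IsIncoherentPreserving (K n))
    {φ χ : EuclideanSpace ℂ ι} (hφ : ‖φ‖ = 1) (hχ : ‖χ‖ = 1)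
    (hmul : ∀ n, ∃ b : ℂ, WithLp.toLp 2 ((K n).mulVec φ) = b • χ) :
    IsMajorizedBy (coeffDist φ) (coeffDist χ) := by
  intro S
  choose f hf using fun n => isIncoherentPreserving_iff.1 (hinc n)
  choose b hb using hmul
  obtain ⟨T, hT, hmax⟩ := Finset.exists_max_image {T : Finset ι | T.card ≤ S.card}
    (fun T => ∑ i ∈ T, coeffDist χ i) ⟨S, by simp⟩
  rw [Finset.mem_filter_univ] at hT
  have hbsum : ∑ n, ‖b n‖ ^ 2 = 1 := by
    have h := sum_norm_sq_mulVec hK φ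
    simpa only [hb, norm_smul, hχ, hφ, mul_one, one_pow] using h
  have hcoeff : ∀ n i, coeffDist (b n • χ) i = ‖b n‖ ^ 2 * coeffDist χ i := fun n i => by
    simp [coeffDist, mul_pow]
  refine ⟨T, hT, ?_⟩
  calc ∑ j ∈ S, coeffDist φ j
      ≤ ∑ n, ∑ i ∈ S.image (f n), coeffDist (WithLp.toLp 2 ((K n).mulVec φ)) i :=
        sum_coeffDist_le_sum_image hK hf φ S
    _ = ∑ n, ‖b n‖ ^ 2 * ∑ i ∈ S.image (f n), coeffDist χ i := by
        simp only [hb, hcoeff, Finset.mul_sum]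
    _ ≤ ∑ n, ‖b n‖ ^ 2 * ∑ i ∈ T, coeffDist χ i := by
        refine Finset.sum_le_sum fun n _ => mul_le_mul_of_nonneg_left (hmax _ ?_) (sq_nonneg _)
        exact (Finset.mem_filter_univ _).2 Finset.card_image_le
    _ = ∑ i ∈ T, coeffDist χ i := by rw [← Finset.sum_mul, hbsum, one_mul]

end Necessity

section Sufficiency

lemma exists_kraus_coeff {ι : Type} {k : ℕ} {w : Fin k → ℝ} (hw0 : ∀ n, 0 ≤ w n)
    (hw1 : ∑ n, w n = 1) {π : Fin k → Equiv.Perm ι} {φ χ : EuclideanSpace ℂ ι}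
    (hw : ∀ i, ∑ n, w n * coeffDist χ (π n i) = coeffDist φ i) :
    ∃ c : Fin k → ι → ℂ, (∀ i, ∑ n, ‖c n i‖ ^ 2 = 1) ∧
      ∀ n, ∃ b : ℂ, ∀ i, c n i * φ i = b * χ (π n i) := by
  have hsq : ∀ n, ‖(√(w n) : ℂ)‖ ^ 2 = w n := fun n => by
    rw [Complex.norm_real, Real.norm_eq_abs, sq_abs, Real.sq_sqrt (hw0 n)]
  refine ⟨fun n i => √(w n) * if φ i = 0 then 1 else χ (π n i) / φ i, fun i => ?_,
    fun n => ⟨√(w n), fun i => ?_⟩⟩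
  · simp only [norm_mul, mul_pow, hsq]
    split_ifs with h0
    · simpa using hw1
    · simp only [norm_div, div_pow, mul_div_assoc', ← Finset.sum_div]
      rw [div_eq_one_iff_eq (by simpa using h0)]
      exact hw i
  · beta_reduce
    split_ifs with h0
    · have hzero : w n * coeffDist χ (π n i) = 0 :=
        (Finset.sum_eq_zero_iff_of_nonneg fun n _ =>
          mul_nonneg (hw0 n) (coeffDist_nonneg χ _)).1
          ((hw i).trans (by simp [coeffDist, h0])) n (Finset.mem_univ n)
      rw [h0, mul_zero, eq_comm, ← norm_eq_zero, ← sq_eq_zero_iff, norm_mul, mul_pow, hsq]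
      exact hzero
    · field_simp

variable {ι : Type} [Fintype ι] [DecidableEq ι]

/-- The monomial matrix of a permutation `π` with coefficients `c`: it maps `|j⟩` to
`c j |π j⟩`. -/
def monomialMatrix (π : Equiv.Perm ι) (c : ι → ℂ) : Matrix ι ι ℂ :=
  Matrix.of fun i j => if i = π j then c j else 0

lemma isIncoherentPreserving_monomialMatrix (π : Equiv.Perm ι) (c : ι → ℂ) :
    IsIncoherentPreserving (monomialMatrix π c) :=
  isIncoherentPreserving_iff.2 ⟨π, fun _ _ => not_imp_not.1 fun h => by
    simp [monomialMatrix, h]⟩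

lemma isIncoherentPreserving_conjTranspose_monomialMatrix (π : Equiv.Perm ι) (c : ι → ℂ) :
    IsIncoherentPreserving (monomialMatrix π c).conjTranspose :=
  isIncoherentPreserving_iff.2 ⟨π.symm, fun _ _ => not_imp_not.1 fun h => by
    rw [Equiv.eq_symm_apply, eq_comm] at h
    simp [monomialMatrix, h]⟩

lemma monomialMatrix_mulVec (π : Equiv.Perm ι) (c v : ι → ℂ) (j : ι) :
    (monomialMatrix π c).mulVec v (π j) = c j * v j := by
  simp [monomialMatrix, Matrix.mulVec, dotProduct]

lemma conjTranspose_mul_monomialMatrix (π : Equiv.Perm ι) (c : ι → ℂ) :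
    (monomialMatrix π c).conjTranspose * monomialMatrix π c =
      Matrix.diagonal fun i => ((‖c i‖ ^ 2 : ℝ) : ℂ) := by
  ext i j
  simp only [Matrix.mul_apply, Matrix.conjTranspose_apply, monomialMatrix, Matrix.of_apply]
  obtain rfl | hij := eq_or_ne i j
  · simp [Complex.conj_mul']
  · simp [hij, hij.symm]

lemma mem_strictlyIncoherent_sum_monomialMatrix {k : ℕ} (π : Fin k → Equiv.Perm ι)
    {c : Fin k → ι → ℂ} (hc : ∀ i, ∑ n, ‖c n i‖ ^ 2 = 1) :
    OpClass.strictlyIncoherent.Mem fun X =>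
      ∑ n, monomialMatrix (π n) (c n) * X * (monomialMatrix (π n) (c n)).conjTranspose := by
  refine ⟨k, fun n => monomialMatrix (π n) (c n), ⟨?_, fun X => rfl⟩, fun n =>
    ⟨isIncoherentPreserving_monomialMatrix _ _,
      isIncoherentPreserving_conjTranspose_monomialMatrix _ _⟩⟩
  simp only [conjTranspose_mul_monomialMatrix]
  ext i j
  rw [Matrix.sum_apply]
  obtain rfl | hij := eq_or_ne i j
  · simp only [Matrix.diagonal_apply_eq, Matrix.one_apply_eq]
    exact_mod_cast hc i
  · simp [hij]

end Sufficiency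

section Conversion

variable {ι : Type} [Fintype ι] [DecidableEq ι] {O : OpClass} {Λ : Matrix ι ι ℂ → Matrix ι ι ℂ}

lemma OpClass.Mem.incoherent (h : O.Mem Λ) : OpClass.incoherent.Mem Λ := by
  cases O with
  | incoherent => exact h
  | strictlyIncoherent =>
    obtain ⟨k, K, hK, hI⟩ := h
    exact ⟨k, K, hK, fun n => (hI n).1⟩

lemma OpClass.Mem.of_strictlyIncoherent (O : OpClass) (h : OpClass.strictlyIncoherent.Mem Λ) :
    O.Mem Λ := by
  cases O with
  | incoherent => exact h.incoherent
  | strictlyIncoherent => exact h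

lemma IsKraus.isState_apply {k : ℕ} {K : Fin k → Matrix ι ι ℂ} (hK : IsKraus K Λ)
    {ρ : Matrix ι ι ℂ} (hρ : IsState ρ) : IsState (Λ ρ) := by
  rw [hK.2 ρ]
  refine ⟨Matrix.posSemidef_sum _ fun n _ => hρ.1.mul_mul_conjTranspose_same (K n), ?_⟩
  calc (∑ n, K n * ρ * (K n).conjTranspose).trace
      = ((∑ n, (K n).conjTranspose * K n) * ρ).trace := by
        rw [Matrix.trace_sum, Finset.sum_mul, Matrix.trace_sum]
        exact Finset.sum_congr rfl fun n _ => Matrix.trace_mul_cycle _ _ _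
    _ = 1 := by rw [hK.1, one_mul, hρ.2]

lemma OpClass.Mem.isState_apply (h : O.Mem Λ) {ρ : Matrix ι ι ℂ} (hρ : IsState ρ) :
    IsState (Λ ρ) := by
  obtain ⟨k, K, hK, -⟩ := h.incoherent
  exact hK.isState_apply hρ

theorem exists_mem_apply_proj_eq_iff (O : OpClass) {φ χ : EuclideanSpace ℂ ι}
    (hφ : ‖φ‖ = 1) (hχ : ‖χ‖ = 1) :
    (∃ Λ : Matrix ι ι ℂ → Matrix ι ι ℂ, O.Mem Λ ∧ Λ (proj φ) = proj χ) ↔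
      IsMajorizedBy (coeffDist φ) (coeffDist χ) := by
  constructor
  · rintro ⟨Λ, hΛ, happly⟩
    obtain ⟨k, K, hK, hinc⟩ := hΛ.incoherent
    rw [hK.2] at happly
    simp only [mul_proj_mul_conjTranspose] at happly
    exact isMajorizedBy_of_kraus hK.1 hinc hφ hχ (exists_eq_smul_of_sum_proj_eq hχ happly)
  · intro h
    obtain ⟨k, w, π, hw0, hw1, hw⟩ := h.exists_weights (coeffDist_nonneg χ)
      (by rw [sum_coeffDist, sum_coeffDist, hφ, hχ])
    obtain ⟨c, hc, hmul⟩ := exists_kraus_coeff hw0 hw1 hw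
    have hmem := mem_strictlyIncoherent_sum_monomialMatrix π hc
    refine ⟨_, .of_strictlyIncoherent O hmem, ?_⟩
    have hstate := hmem.isState_apply (isState_proj hφ)
    simp only [mul_proj_mul_conjTranspose] at hstate ⊢
    refine sum_proj_eq_of_forall_eq_smul hχ (fun n => ?_) hstate.2
    obtain ⟨b, hb⟩ := hmul n
    refine ⟨b, ?_⟩
    ext i
    obtain ⟨j, rfl⟩ := (π n).surjective i
    rw [PiLp.smul_apply, smul_eq_mul, ← hb]
    exact monomialMatrix_mulVec _ _ _ _

end Conversion

section Tensor

variable {α β : Type}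

/-- The product vector `|φ⟩ ⊗ |ω⟩`. -/
def tensorVec (φ : EuclideanSpace ℂ α) (ω : EuclideanSpace ℂ β) : EuclideanSpace ℂ (α × β) :=
  WithLp.toLp 2 fun x => φ x.1 * ω x.2

lemma coeffDist_tensorVec (φ : EuclideanSpace ℂ α) (ω : EuclideanSpace ℂ β) :
    coeffDist (tensorVec φ ω) = fun x => coeffDist φ x.1 * coeffDist ω x.2 := by
  ext x
  simp [coeffDist, tensorVec, mul_pow]

lemma exists_eq_smul_tensorVec {v : EuclideanSpace ℂ (α × β)} {χ : EuclideanSpace ℂ α}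
    {ω : EuclideanSpace ℂ β} (hω : ω ≠ 0)
    (hrow : ∀ i, ∃ a : ℂ, WithLp.toLp 2 (fun j => v (i, j)) = a • ω)
    (hcol : ∀ j, ∃ c : ℂ, WithLp.toLp 2 (fun i => v (i, j)) = c • χ) :
    ∃ b : ℂ, v = b • tensorVec χ ω := by
  choose a ha using hrow
  choose c hc using hcol
  have hva : ∀ i j, v (i, j) = a i * ω j := fun i j => congrArg (fun u => u j) (ha i)
  have hvc : ∀ i j, v (i, j) = c j * χ i := fun i j => congrArg (fun u => u i) (hc j)
  obtain ⟨j₀, hj₀⟩ : ∃ j, ω j ≠ 0 := by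
    by_contra! h
    exact hω (by ext j; exact h j)
  refine ⟨c j₀ / ω j₀, ?_⟩
  ext ⟨i, j⟩
  have hai : a i = c j₀ * χ i / ω j₀ := by rw [← hvc, hva, mul_div_cancel_right₀ _ hj₀]
  simp only [PiLp.smul_apply, smul_eq_mul, tensorVec]
  rw [hva, hai]
  ring

lemma traceA_kronecker [Fintype α] (X : Matrix α α ℂ) (Y : Matrix β β ℂ) :
    traceA (X ⊗ₖ Y) = X.trace • Y := by
  ext j j'
  simp [traceA, Matrix.trace, Finset.sum_mul]

lemma traceC_kronecker [Fintype β] (X : Matrix α α ℂ) (Y : Matrix β β ℂ) :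
    traceC (X ⊗ₖ Y) = Y.trace • X := by
  ext i i'
  simp [traceC, Matrix.trace, ← Finset.mul_sum, mul_comm]

variable [Fintype α] [Fintype β]

lemma proj_kronecker_proj (φ : EuclideanSpace ℂ α) (ω : EuclideanSpace ℂ β) :
    proj φ ⊗ₖ proj ω = proj (tensorVec φ ω) := by
  ext ⟨i, j⟩ ⟨i', j'⟩
  simp only [Matrix.kroneckerMap_apply, proj, Matrix.of_apply, tensorVec, star_mul']
  ring

lemma norm_tensorVec (φ : EuclideanSpace ℂ α) (ω : EuclideanSpace ℂ β) :
    ‖tensorVec φ ω‖ = ‖φ‖ * ‖ω‖ := by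
  rw [← sq_eq_sq₀ (norm_nonneg _) (by positivity), mul_pow, ← sum_coeffDist, ← sum_coeffDist,
    ← sum_coeffDist, Finset.sum_mul_sum, coeffDist_tensorVec, Fintype.sum_prod_type]

lemma traceA_sum_proj {κ : Type} [Fintype κ] (v : κ → EuclideanSpace ℂ (α × β)) :
    traceA (∑ n, proj (v n)) =
      ∑ x : κ × α, proj (WithLp.toLp 2 fun j => v x.1 (x.2, j)) := by
  ext j j'
  simp only [traceA, Matrix.of_apply, Matrix.sum_apply, Fintype.sum_prod_type]
  exact Finset.sum_comm

lemma traceC_sum_proj {κ : Type} [Fintype κ] (v : κ → EuclideanSpace ℂ (α × β)) :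
    traceC (∑ n, proj (v n)) =
      ∑ x : κ × β, proj (WithLp.toLp 2 fun i => v x.1 (i, x.2)) := by
  ext i i'
  simp only [traceC, Matrix.of_apply, Matrix.sum_apply, Fintype.sum_prod_type]
  exact Finset.sum_comm

theorem IsState.traceA_eq_and_traceC_eq_iff {X : Matrix (α × β) (α × β) ℂ} (hX : IsState X)
    {χ : EuclideanSpace ℂ α} {ω : EuclideanSpace ℂ β} (hχ : ‖χ‖ = 1) (hω : ‖ω‖ = 1) :
    traceA X = proj ω ∧ traceC X = proj χ ↔ X = proj (tensorVec χ ω) := by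
  constructor
  · rintro ⟨hA, hC⟩
    obtain ⟨k, v, rfl⟩ := exists_eq_sum_proj hX.1
    rw [traceA_sum_proj] at hA
    rw [traceC_sum_proj] at hC
    refine sum_proj_eq_of_forall_eq_smul (by rw [norm_tensorVec, hχ, hω, one_mul])
      (fun n => exists_eq_smul_tensorVec (norm_ne_zero_iff.1 (by simp [hω])) (fun i => ?_)
        fun j => ?_) hX.2
    · exact exists_eq_smul_of_sum_proj_eq hω hA (n, i)
    · exact exists_eq_smul_of_sum_proj_eq hχ hC (n, j)
  · rintro rfl
    rw [← proj_kronecker_proj, traceA_kronecker, traceC_kronecker, (isState_proj hχ).2,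
      (isState_proj hω).2, one_smul, one_smul]
    exact ⟨rfl, rfl⟩

end Tensor

section SqrtVec

variable {ι : Type}

/-- The vector with coefficients `√(q i)`, whose squared moduli are the weights `q`. -/
def sqrtVec (q : ι → ℝ) : EuclideanSpace ℂ ι :=
  WithLp.toLp 2 fun i => (√(q i) : ℂ)

lemma coeffDist_sqrtVec {q : ι → ℝ} (hq : ∀ i, 0 ≤ q i) : coeffDist (sqrtVec q) = q := by
  ext i
  simp [coeffDist, sqrtVec, Real.sq_sqrt (hq i)]

variable [Fintype ι]

lemma inner_sqrtVec (p q : ι → ℝ) :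
    inner ℂ (sqrtVec p) (sqrtVec q) = ((∑ i, √(p i) * √(q i) : ℝ) : ℂ) := by
  simp [PiLp.inner_apply, sqrtVec, mul_comm]

lemma one_sub_norm_inner_sqrtVec_sq_le {p q : ι → ℝ} (hp : ∀ i, 0 ≤ p i) (hq : ∀ i, 0 ≤ q i) :
    1 - ‖(inner ℂ (sqrtVec p) (sqrtVec q) : ℂ)‖ ^ 2 ≤ 2 * (1 - ∑ i, min (p i) (q i)) := by
  have hmin : ∀ i, min (p i) (q i) ≤ √(p i) * √(q i) := fun i => by
    have h0 : 0 ≤ min (p i) (q i) := le_min (hp i) (hq i)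
    rw [← Real.mul_self_sqrt h0]
    gcongr
    exacts [min_le_left _ _, min_le_right _ _]
  have hsq : (∑ i, min (p i) (q i)) ^ 2 ≤ ‖(inner ℂ (sqrtVec p) (sqrtVec q) : ℂ)‖ ^ 2 := by
    rw [inner_sqrtVec, Complex.norm_real, Real.norm_eq_abs, sq_abs]
    exact pow_le_pow_left₀ (Finset.sum_nonneg fun i _ => le_min (hp i) (hq i))
      (Finset.sum_le_sum fun i _ => hmin i) 2
  linarith [sq_nonneg (1 - ∑ i, min (p i) (q i))]

end SqrtVec

section MaxCoherent

variable {d N : ℕ}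

lemma maxCoherent_eq_sqrtVec (d N : ℕ) :
    maxCoherent d N = sqrtVec fun i : Fin d => if (i : ℕ) < N then (N : ℝ)⁻¹ else 0 := by
  ext i
  simp only [maxCoherent, sqrtVec]
  split_ifs <;> simp

lemma coeffDist_maxCoherent (i : Fin d) :
    coeffDist (maxCoherent d N) i = if (i : ℕ) < N then (N : ℝ)⁻¹ else 0 := by
  rw [maxCoherent_eq_sqrtVec, coeffDist_sqrtVec]
  intro i
  split_ifs <;> positivity

lemma coeffDist_maxCoherent_le (i : Fin d) : coeffDist (maxCoherent d N) i ≤ (N : ℝ)⁻¹ := by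
  rw [coeffDist_maxCoherent]
  split_ifs
  · exact le_rfl
  · positivity

lemma norm_maxCoherent (h1 : 1 ≤ N) (hN : N ≤ d) : ‖maxCoherent d N‖ = 1 := by
  rw [← sum_coeffDist_eq_one_iff]
  simp only [coeffDist_maxCoherent]
  rw [← Finset.sum_filter, Finset.sum_const, Fin.card_filter_val_lt, min_eq_right hN,
    nsmul_eq_mul, mul_inv_cancel₀ (by positivity)]

lemma norm_inner_maxCoherent_sq_le {χ : EuclideanSpace ℂ (Fin d)} (hχ : ‖χ‖ = 1) :
    ‖(inner ℂ (maxCoherent d N) χ : ℂ)‖ ^ 2 ≤ coherenceRank χ / N := by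
  classical
  calc ‖(inner ℂ (maxCoherent d N) χ : ℂ)‖ ^ 2
      ≤ ∑ i with χ i ≠ 0, coeffDist (maxCoherent d N) i :=
        norm_inner_sq_le_sum_coeffDist hχ fun i hi => by simpa using hi
    _ ≤ ∑ i with χ i ≠ 0, (N : ℝ)⁻¹ := Finset.sum_le_sum fun i _ => coeffDist_maxCoherent_le i
    _ = coherenceRank χ / N := by
        rw [Finset.sum_const, nsmul_eq_mul, div_eq_mul_inv, coherenceRank,
          Nat.card_eq_fintype_card, Fintype.card_subtype]

/-- The weights equal to `c` before the index `i₀` and to the remainder `1 - i₀ * c` at `i₀`. They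
serve as a target of conversion: every distribution bounded by `c` is majorized by them. -/
def stepDist (i₀ : Fin d) (c : ℝ) (i : Fin d) : ℝ :=
  (if i < i₀ then c else 0) + if i = i₀ then 1 - i₀ * c else 0

lemma sum_ite_lt_add_ite_eq (i₀ : Fin d) (a b : ℝ) :
    ∑ i, ((if i < i₀ then a else 0) + if i = i₀ then b else 0) = i₀ * a + b := by
  rw [Finset.sum_add_distrib, Finset.sum_ite_eq' Finset.univ, if_pos (Finset.mem_univ _),
    ← Finset.sum_filter, Finset.filter_gt_eq_Iio, Finset.sum_const, Fin.card_Iio, nsmul_eq_mul]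

lemma sum_stepDist (i₀ : Fin d) (c : ℝ) : ∑ i, stepDist i₀ c i = 1 := by
  simp only [stepDist, sum_ite_lt_add_ite_eq, add_sub_cancel]

lemma stepDist_nonneg {i₀ : Fin d} {c : ℝ} (hc : 0 ≤ c) (h : i₀ * c ≤ 1) (i : Fin d) :
    0 ≤ stepDist i₀ c i := by
  rw [← sub_nonneg] at h
  unfold stepDist
  positivity

lemma isMajorizedBy_stepDist {p : Fin d → ℝ} (hp : ∀ i, 0 ≤ p i) (hsum : ∑ i, p i = 1)
    (i₀ : Fin d) {c : ℝ} (hpc : ∀ i, p i ≤ c) : IsMajorizedBy p (stepDist i₀ c) := by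
  refine isMajorizedBy_of_forall_le (F := Finset.Iio i₀) (G := Finset.Iic i₀) hp hpc
    (fun i hi => ?_) (by simp) (le_of_eq ?_)
  · have hlt := Finset.mem_Iio.1 hi
    simp [stepDist, hlt, hlt.ne]
  · rw [hsum, ← sum_stepDist i₀ c]
    refine (Finset.sum_subset (Finset.subset_univ _) fun i _ hi => ?_).symm
    have hlt : i₀ < i := by simpa using hi
    simp [stepDist, hlt.not_gt, hlt.ne']

lemma one_sub_mul_le_sum_min_stepDist (i₀ : Fin d) {ε : ℝ} (hε : 0 ≤ ε) :
    1 - i₀ * ε ≤ ∑ i : Fin d, min (if (i : ℕ) < i₀ + 1 then ((i₀ + 1 : ℕ) : ℝ)⁻¹ else 0)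
      (stepDist i₀ (((i₀ + 1 : ℕ) : ℝ)⁻¹ + ε) i) := by
  set t : ℝ := ((i₀ + 1 : ℕ) : ℝ)⁻¹ with ht
  have htN : i₀ * t + t = 1 := by
    rw [ht, ← add_one_mul]
    push_cast
    exact mul_inv_cancel₀ (by positivity)
  have hε' : 0 ≤ i₀ * ε := by positivity
  calc 1 - i₀ * ε = ∑ i, ((if i < i₀ then t else 0) + if i = i₀ then 1 - i₀ * (t + ε) else 0) := by
        rw [sum_ite_lt_add_ite_eq]
        ring
    _ ≤ _ := Finset.sum_le_sum fun i _ => ?_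
  obtain h | rfl | h := lt_trichotomy i i₀
  · simp [stepDist, h, h.ne, hε, Nat.lt_succ_of_lt h]
  · simp only [stepDist, lt_irrefl, if_true, if_false, zero_add, Nat.lt_succ_self, le_min_iff,
      le_refl, and_true]
    linarith
  · simp [stepDist, h.not_gt, h.ne', Nat.not_lt.2 (Nat.succ_le_of_lt h)]

theorem exists_isMajorizedBy_near_maxCoherent {φ : EuclideanSpace ℂ (Fin d)} (hφ : ‖φ‖ = 1)
    (h1 : 1 ≤ N) (hN : N ≤ d) {ε : ℝ} (hε : 0 ≤ ε) (hNε : N * (N - 1) * ε ≤ 1)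
    (hφε : ∀ i, coeffDist φ i ≤ (N : ℝ)⁻¹ + ε) :
    ∃ χ : EuclideanSpace ℂ (Fin d), ‖χ‖ = 1 ∧ IsMajorizedBy (coeffDist φ) (coeffDist χ) ∧
      1 - ‖(inner ℂ (maxCoherent d N) χ : ℂ)‖ ^ 2 ≤ 2 * (N - 1) * ε := by
  obtain ⟨i₀, rfl⟩ : ∃ i₀ : Fin d, N = i₀ + 1 := ⟨⟨N - 1, by omega⟩, (Nat.sub_add_cancel h1).symm⟩
  set c : ℝ := ((i₀ + 1 : ℕ) : ℝ)⁻¹ + ε with hc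
  have hNc : ((i₀ + 1 : ℕ) : ℝ) * c = 1 + (i₀ + 1 : ℕ) * ε := by
    rw [hc, mul_add, mul_inv_cancel₀ (by positivity)]
  have hle : i₀ * c ≤ 1 := by
    refine le_of_mul_le_mul_left ?_ (by positivity : (0 : ℝ) < (i₀ + 1 : ℕ))
    rw [mul_left_comm, hNc]
    push_cast at hNε ⊢
    linarith
  have hq := stepDist_nonneg (by positivity) hle
  refine ⟨sqrtVec (stepDist i₀ c), ?_, ?_, ?_⟩
  · rw [← sum_coeffDist_eq_one_iff, coeffDist_sqrtVec hq, sum_stepDist]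
  · rw [coeffDist_sqrtVec hq]
    exact isMajorizedBy_stepDist (coeffDist_nonneg φ) (sum_coeffDist_eq_one_iff.2 hφ) i₀ hφε
  · rw [maxCoherent_eq_sqrtVec]
    refine (one_sub_norm_inner_sqrtVec_sq_le (fun i => ?_) hq).trans ?_
    · split_ifs <;> positivity
    · have hmin := one_sub_mul_le_sum_min_stepDist i₀ hε
      rw [← hc] at hmin
      rw [Nat.cast_add_one (i₀ : ℕ), add_sub_cancel_right, ← Nat.cast_add_one]
      linarith

end MaxCoherent

section Catalysis

variable {d m N : ℕ} {O : OpClass} {ε : ℝ} {φ χ : EuclideanSpace ℂ (Fin d)}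
  {ω : EuclideanSpace ℂ (Fin m)}

lemma IsMajorizedBy.coherenceRank_le_of_tensorVec
    (h : IsMajorizedBy (coeffDist (tensorVec φ ω)) (coeffDist (tensorVec χ ω)))
    (hφ : ‖φ‖ = 1) (hχ : ‖χ‖ = 1) (hω : ‖ω‖ = 1) : coherenceRank χ ≤ coherenceRank φ := by
  have hrank : ∀ ψ : EuclideanSpace ℂ (Fin d),
      (coeffDist ψ).support.ncard = coherenceRank ψ := fun ψ => by
    rw [coherenceRank, ← Nat.card_coe_set_eq]
    exact Nat.card_congr (Equiv.subtypeEquivRight fun i => by simp [coeffDist])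
  simp only [coeffDist_tensorVec] at h
  rw [← hrank, ← hrank]
  exact h.ncard_support_le_of_mul (coeffDist_nonneg χ) (coeffDist_nonneg ω) (coeffDist_ne_zero hω)
    (by rw [sum_coeffDist, sum_coeffDist, hφ, hχ])

theorem mem_pureDistillSet_iff (hφ : ‖φ‖ = 1) :
    N ∈ pureDistillSet O ε φ ↔ 1 ≤ N ∧ N ≤ d ∧ ∃ χ : EuclideanSpace ℂ (Fin d), ‖χ‖ = 1 ∧
      IsMajorizedBy (coeffDist φ) (coeffDist χ) ∧
      purifiedDist (proj χ) (proj (maxCoherent d N)) ≤ ε := by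
  refine and_congr_right fun _ => and_congr_right fun _ => ⟨?_, ?_⟩
  · rintro ⟨Λ, χ, hΛ, hχ, hout, hP⟩
    exact ⟨χ, hχ, (exists_mem_apply_proj_eq_iff O hφ hχ).1 ⟨Λ, hΛ, hout⟩, hP⟩
  · rintro ⟨χ, hχ, hmaj, hP⟩
    obtain ⟨Λ, hΛ, hout⟩ := (exists_mem_apply_proj_eq_iff O hφ hχ).2 hmaj
    exact ⟨Λ, χ, hΛ, hχ, hout, hP⟩

theorem mem_pureDistillPcSet_iff (hφ : ‖φ‖ = 1) :
    N ∈ pureDistillPcSet O ε φ ↔ 1 ≤ N ∧ N ≤ d ∧ ∃ (m : ℕ) (ω : EuclideanSpace ℂ (Fin m))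
      (χ : EuclideanSpace ℂ (Fin d)), ‖ω‖ = 1 ∧ ‖χ‖ = 1 ∧
      IsMajorizedBy (coeffDist (tensorVec φ ω)) (coeffDist (tensorVec χ ω)) ∧
      purifiedDist (proj χ) (proj (maxCoherent d N)) ≤ ε := by
  have hnorm : ∀ {m} {ψ : EuclideanSpace ℂ (Fin d)} {ω : EuclideanSpace ℂ (Fin m)},
      ‖ψ‖ = 1 → ‖ω‖ = 1 → ‖tensorVec ψ ω‖ = 1 := fun hψ hω => by
    rw [norm_tensorVec, hψ, hω, one_mul]
  refine and_congr_right fun _ => and_congr_right fun _ => ⟨?_, ?_⟩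
  · rintro ⟨m, Λ, ω, χ, hΛ, hω, hχ, hA, hC, hP⟩
    rw [proj_kronecker_proj] at hA hC
    have hout := ((hΛ.isState_apply (isState_proj (hnorm hφ hω))).traceA_eq_and_traceC_eq_iff
      hχ hω).1 ⟨hA, hC⟩
    exact ⟨m, ω, χ, hω, hχ, (exists_mem_apply_proj_eq_iff O (hnorm hφ hω) (hnorm hχ hω)).1
      ⟨Λ, hΛ, hout⟩, hP⟩
  · rintro ⟨m, ω, χ, hω, hχ, hmaj, hP⟩
    obtain ⟨Λ, hΛ, hout⟩ :=
      (exists_mem_apply_proj_eq_iff O (hnorm hφ hω) (hnorm hχ hω)).2 hmaj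
    obtain ⟨hA, hC⟩ := ((hΛ.isState_apply
      (isState_proj (hnorm hφ hω))).traceA_eq_and_traceC_eq_iff hχ hω).2 hout
    rw [← proj_kronecker_proj] at hA hC
    exact ⟨m, Λ, ω, χ, hΛ, hω, hχ, hA, hC, hP⟩

theorem pureDistillSet_subset_pureDistillPcSet (hφ : ‖φ‖ = 1) :
    pureDistillSet O ε φ ⊆ pureDistillPcSet O ε φ := by
  intro N hN
  obtain ⟨h1, hNd, χ, hχ, hmaj, hP⟩ := (mem_pureDistillSet_iff hφ).1 hN
  refine (mem_pureDistillPcSet_iff hφ).2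
    ⟨h1, hNd, 1, EuclideanSpace.single 0 1, χ, by simp, hχ, ?_, hP⟩
  have htensor : ∀ ψ : EuclideanSpace ℂ (Fin d),
      coeffDist (tensorVec ψ (EuclideanSpace.single (0 : Fin 1) 1)) =
        coeffDist ψ ∘ Equiv.prodUnique (Fin d) (Fin 1) := fun ψ => by
    ext ⟨i, j⟩
    simp [coeffDist, tensorVec, Subsingleton.elim j 0]
  rw [htensor, htensor]
  exact hmaj.comp_equiv _ _

lemma coeffDist_le_of_mem_pureDistillPcSet (hφ : ‖φ‖ = 1) (hε : 0 ≤ ε)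
    (h : N ∈ pureDistillPcSet O ε φ) (i : Fin d) : coeffDist φ i ≤ (N : ℝ)⁻¹ + ε := by
  obtain ⟨h1, hNd, m, ω, χ, hω, hχ, hmaj, hP⟩ := (mem_pureDistillPcSet_iff hφ).1 h
  simp only [coeffDist_tensorVec] at hmaj
  obtain ⟨j, hj⟩ := hmaj.exists_le_of_mul (coeffDist_nonneg χ) (coeffDist_nonneg ω)
    (coeffDist_ne_zero hω) i
  rw [purifiedDist_proj_proj_le_iff hε] at hP
  calc coeffDist φ i ≤ coeffDist χ j := hj
    _ ≤ coeffDist (maxCoherent d N) j + ε := by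
        simpa using sum_coeffDist_le_add hχ (norm_maxCoherent h1 hNd) hε hP {j}
    _ ≤ (N : ℝ)⁻¹ + ε := by
        gcongr
        exact coeffDist_maxCoherent_le j

lemma one_sub_coherenceRank_div_le_sq (hφ : ‖φ‖ = 1) (hε : 0 ≤ ε)
    (h : N ∈ pureDistillPcSet O ε φ) : 1 - coherenceRank φ / N ≤ ε ^ 2 := by
  obtain ⟨-, -, m, ω, χ, hω, hχ, hmaj, hP⟩ := (mem_pureDistillPcSet_iff hφ).1 h
  rw [purifiedDist_proj_proj_le_iff hε] at hP
  calc 1 - (coherenceRank φ : ℝ) / N ≤ 1 - coherenceRank χ / N := by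
        gcongr
        exact hmaj.coherenceRank_le_of_tensorVec hφ hχ hω
    _ ≤ 1 - ‖(inner ℂ (maxCoherent d N) χ : ℂ)‖ ^ 2 := by
        gcongr
        exact norm_inner_maxCoherent_sq_le hχ
    _ ≤ ε ^ 2 := hP

lemma sq_mul_add_one_lt_one {r : ℝ} (hr : 2 ≤ r) (hε : 0 ≤ ε) (hrε : r * (r - 1) * ε ≤ 1) :
    ε ^ 2 * (r + 1) < 1 := by
  have hr1 : r ≤ r * (r - 1) := by nlinarith
  have hr2 : r + 1 < (r * (r - 1)) ^ 2 :=
    calc r + 1 < r ^ 2 := by nlinarith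
      _ ≤ (r * (r - 1)) ^ 2 := by gcongr
  obtain rfl | hε := hε.eq_or_lt
  · simp
  calc ε ^ 2 * (r + 1) < ε ^ 2 * (r * (r - 1)) ^ 2 := by gcongr
    _ = (r * (r - 1) * ε) ^ 2 := by ring
    _ ≤ 1 := pow_le_one₀ (by have := sub_nonneg.2 (one_le_two.trans hr); positivity) hrε

lemma le_coherenceRank_of_mem_pureDistillPcSet (hφ : ‖φ‖ = 1) (hε : 0 ≤ ε)
    (hr : 1 < coherenceRank φ)
    (hrε : (coherenceRank φ : ℝ) * (coherenceRank φ - 1) * ε ≤ 1)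
    (h : N ∈ pureDistillPcSet O ε φ) : N ≤ coherenceRank φ := by
  by_contra! hlt
  have hle : 1 - coherenceRank φ / ((coherenceRank φ : ℝ) + 1) ≤ ε ^ 2 := by
    refine le_trans ?_ (one_sub_coherenceRank_div_le_sq hφ hε h)
    gcongr
    exact_mod_cast hlt
  rw [one_sub_div (by positivity), add_sub_cancel_left, div_le_iff₀ (by positivity)] at hle
  exact hle.not_gt (sq_mul_add_one_lt_one (by exact_mod_cast hr) hε hrε)

lemma mem_pureDistillSet_of_one_le (hφ : ‖φ‖ = 1) (hε : 1 ≤ ε) (h1 : 1 ≤ N) (hNd : N ≤ d) :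
    N ∈ pureDistillSet O ε φ :=
  (mem_pureDistillSet_iff hφ).2 ⟨h1, hNd, φ, hφ, .refl _, (purifiedDist_le_one _ _).trans hε⟩

theorem pureDistillPcSet_subset_pureDistillSet_sqrt (hφ : ‖φ‖ = 1) (hε : 0 ≤ ε)
    (hr : 1 < coherenceRank φ) :
    pureDistillPcSet O ε φ ⊆
      pureDistillSet O √((coherenceRank φ : ℝ) * (coherenceRank φ - 1) * ε) φ := by
  intro N hN
  obtain hrε | hrε := lt_or_ge 1 ((coherenceRank φ : ℝ) * (coherenceRank φ - 1) * ε)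
  · exact mem_pureDistillSet_of_one_le hφ (Real.one_le_sqrt.2 hrε.le) hN.1 hN.2.1
  have hr2 : (2 : ℝ) ≤ coherenceRank φ := by exact_mod_cast hr
  have hN1 : (1 : ℝ) ≤ N := by exact_mod_cast hN.1
  have hNr : (N : ℝ) ≤ coherenceRank φ := by
    exact_mod_cast le_coherenceRank_of_mem_pureDistillPcSet hφ hε hr hrε hN
  have hle : (N : ℝ) * (N - 1) ≤ coherenceRank φ * (coherenceRank φ - 1) := by gcongr
  have hle2 : 2 * ((N : ℝ) - 1) ≤ coherenceRank φ * (coherenceRank φ - 1) := by gcongr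
  obtain ⟨χ, hχ, hmaj, hoverlap⟩ := exists_isMajorizedBy_near_maxCoherent hφ hN.1 hN.2.1 hε
    ((mul_le_mul_of_nonneg_right hle hε).trans hrε)
    (coeffDist_le_of_mem_pureDistillPcSet hφ hε hN)
  refine (mem_pureDistillSet_iff hφ).2 ⟨hN.1, hN.2.1, χ, hχ, hmaj, ?_⟩
  rw [purifiedDist_proj_proj_le_iff (Real.sqrt_nonneg _),
    Real.sq_sqrt (mul_nonneg (by nlinarith) hε)]
  exact hoverlap.trans (mul_le_mul_of_nonneg_right hle2 hε)

end Catalysis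

section ExactDistillation

variable {d N : ℕ} {O : OpClass} {ε : ℝ} {φ : EuclideanSpace ℂ (Fin d)}

lemma mem_pureDistillSet_of_coeffDist_le (hφ : ‖φ‖ = 1) (hε : 0 ≤ ε) (h1 : 1 ≤ N) (hNd : N ≤ d)
    (h : ∀ i, coeffDist φ i ≤ (N : ℝ)⁻¹) : N ∈ pureDistillSet O ε φ := by
  obtain ⟨χ, hχ, hmaj, hoverlap⟩ := exists_isMajorizedBy_near_maxCoherent hφ h1 hNd le_rfl
    (by simp) (by simpa using h)
  refine (mem_pureDistillSet_iff hφ).2 ⟨h1, hNd, χ, hχ, hmaj, ?_⟩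
  rw [purifiedDist_proj_proj_le_iff hε]
  exact (hoverlap.trans_eq (mul_zero _)).trans (sq_nonneg ε)

lemma pos_of_norm_eq_one (hφ : ‖φ‖ = 1) : 0 < d := by
  obtain ⟨i, -⟩ := Function.ne_iff.1 (coeffDist_ne_zero hφ)
  exact i.pos

lemma coeffDist_le_one (hφ : ‖φ‖ = 1) (i : Fin d) : coeffDist φ i ≤ 1 := by
  rw [← sum_coeffDist_eq_one_iff.2 hφ]
  exact Finset.single_le_sum (fun i _ => coeffDist_nonneg φ i) (Finset.mem_univ i)

lemma one_mem_pureDistillSet (hφ : ‖φ‖ = 1) (hε : 0 ≤ ε) : 1 ∈ pureDistillSet O ε φ :=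
  mem_pureDistillSet_of_coeffDist_le hφ hε le_rfl (pos_of_norm_eq_one hφ)
    (by simpa using coeffDist_le_one hφ)

lemma one_le_mul_maxCoeff (hφ : ‖φ‖ = 1) : 1 ≤ d * maxCoeff φ := by
  have hle : ∀ i, coeffDist φ i ≤ maxCoeff φ := le_ciSup (Set.finite_range _).bddAbove
  calc 1 = ∑ i, coeffDist φ i := (sum_coeffDist_eq_one_iff.2 hφ).symm
    _ ≤ ∑ _ : Fin d, maxCoeff φ := Finset.sum_le_sum fun i _ => hle i
    _ = d * maxCoeff φ := by simp

lemma maxCoeff_pos (hφ : ‖φ‖ = 1) : 0 < maxCoeff φ :=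
  pos_of_mul_pos_right (zero_lt_one.trans_le (one_le_mul_maxCoeff hφ)) (Nat.cast_nonneg d)

lemma le_floor_inv_maxCoeff_iff (hφ : ‖φ‖ = 1) (h1 : 1 ≤ N) :
    N ≤ ⌊1 / maxCoeff φ⌋₊ ↔ ∀ i, coeffDist φ i ≤ (N : ℝ)⁻¹ := by
  have hpos := maxCoeff_pos hφ
  have : Nonempty (Fin d) := ⟨⟨0, pos_of_norm_eq_one hφ⟩⟩
  rw [Nat.le_floor_iff (by positivity), le_div_comm₀ (by positivity) hpos, one_div]
  exact ciSup_le_iff (Set.finite_range _).bddAbove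

lemma floor_inv_maxCoeff_le (hφ : ‖φ‖ = 1) : ⌊1 / maxCoeff φ⌋₊ ≤ d :=
  Nat.floor_le_of_le ((div_le_iff₀ (maxCoeff_pos hφ)).2 (one_le_mul_maxCoeff hφ))

lemma pureDistillPcSet_zero_subset_Icc (hφ : ‖φ‖ = 1) :
    pureDistillPcSet O 0 φ ⊆ Set.Icc 1 ⌊1 / maxCoeff φ⌋₊ := fun N hN =>
  ⟨hN.1, (le_floor_inv_maxCoeff_iff hφ hN.1).2 fun i => by
    simpa using coeffDist_le_of_mem_pureDistillPcSet hφ le_rfl hN i⟩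

lemma Icc_subset_pureDistillSet_zero (hφ : ‖φ‖ = 1) :
    Set.Icc 1 ⌊1 / maxCoeff φ⌋₊ ⊆ pureDistillSet O 0 φ := fun _ hN =>
  mem_pureDistillSet_of_coeffDist_le hφ le_rfl hN.1 (hN.2.trans (floor_inv_maxCoeff_le hφ))
    ((le_floor_inv_maxCoeff_iff hφ hN.1).1 hN.2)

theorem pureDistillSet_zero_eq_Icc (hφ : ‖φ‖ = 1) :
    pureDistillSet O 0 φ = Set.Icc 1 ⌊1 / maxCoeff φ⌋₊ :=
  ((pureDistillSet_subset_pureDistillPcSet hφ).trans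
    (pureDistillPcSet_zero_subset_Icc hφ)).antisymm (Icc_subset_pureDistillSet_zero hφ)

theorem pureDistillPcSet_zero_eq_Icc (hφ : ‖φ‖ = 1) :
    pureDistillPcSet O 0 φ = Set.Icc 1 ⌊1 / maxCoeff φ⌋₊ :=
  (pureDistillPcSet_zero_subset_Icc hφ).antisymm
    ((Icc_subset_pureDistillSet_zero hφ).trans (pureDistillSet_subset_pureDistillPcSet hφ))

theorem distillSet_zero_eq_pureDistillSet (hφ : ‖φ‖ = 1) :
    distillSet O 0 (proj φ) = pureDistillSet O 0 φ := by
  ext N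
  refine and_congr_right fun h1 => and_congr_right fun hNd => ⟨?_, ?_⟩
  · rintro ⟨Λ, hΛ, hP⟩
    have hout := (hΛ.isState_apply (isState_proj hφ)).eq_proj_of_purifiedDist_le_zero
      (norm_maxCoherent h1 hNd) hP
    exact ⟨Λ, _, hΛ, norm_maxCoherent h1 hNd, hout, hout ▸ hP⟩
  · rintro ⟨Λ, χ, hΛ, -, hout, hP⟩
    exact ⟨Λ, hΛ, hout ▸ hP⟩

theorem distillPcSet_zero_eq_pureDistillPcSet (φ : EuclideanSpace ℂ (Fin d)) :
    distillPcSet O 0 (proj φ) = pureDistillPcSet O 0 φ := by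
  ext N
  refine and_congr_right fun h1 => and_congr_right fun hNd => ⟨?_, ?_⟩
  · rintro ⟨m, Λ, ω, ρ, hΛ, hω, hρ, hA, hC, hP⟩
    obtain rfl := hρ.eq_proj_of_purifiedDist_le_zero (norm_maxCoherent h1 hNd) hP
    exact ⟨m, Λ, ω, _, hΛ, hω, norm_maxCoherent h1 hNd, hA, hC, hP⟩
  · rintro ⟨m, Λ, ω, χ, hΛ, hω, hχ, hA, hC, hP⟩
    exact ⟨m, Λ, ω, _, hΛ, hω, isState_proj hχ, hA, hC, hP⟩

end ExactDistillation

section LogSet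

variable {S T : Set ℕ} {d M : ℕ}

lemma finite_logSet (hS : S ⊆ Set.Iic d) : (logSet S).Finite :=
  ((Set.finite_Iic d).subset hS).image _

lemma isGreatest_sSup_logSet (hS : S ⊆ Set.Iic d) (h : S.Nonempty) :
    IsGreatest (logSet S) (sSup (logSet S)) :=
  ⟨(h.image _).csSup_mem (finite_logSet hS),
    fun _ hx => le_csSup (finite_logSet hS).bddAbove hx⟩

lemma sSup_logSet_mono (hT : T ⊆ Set.Iic d) (h : S.Nonempty) (hST : S ⊆ T) :
    sSup (logSet S) ≤ sSup (logSet T) :=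
  csSup_le_csSup (finite_logSet hT).bddAbove (h.image _) (Set.image_mono hST)

lemma sSup_logSet_Icc (hM : 1 ≤ M) : sSup (logSet (Set.Icc 1 M)) = Real.logb 2 M := by
  refine IsGreatest.csSup_eq ⟨⟨M, ⟨hM, le_rfl⟩, rfl⟩, ?_⟩
  rintro _ ⟨N, ⟨h1, hN⟩, rfl⟩
  exact Real.logb_le_logb_of_le one_lt_two (by exact_mod_cast h1) (by exact_mod_cast hN)

end LogSet

section Distillation

variable {d : ℕ} {ε : ℝ} {φ : EuclideanSpace ℂ (Fin d)}

lemma isGreatest_Ctilde_d (O : OpClass) (hφ : ‖φ‖ = 1) (hε : 0 ≤ ε) :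
    IsGreatest (logSet (pureDistillSet O ε φ)) (Ctilde_d O ε φ) :=
  isGreatest_sSup_logSet (fun _ hN => hN.2.1) ⟨1, one_mem_pureDistillSet hφ hε⟩

lemma isGreatest_Ctilde_pc (O : OpClass) (hφ : ‖φ‖ = 1) (hε : 0 ≤ ε) :
    IsGreatest (logSet (pureDistillPcSet O ε φ)) (Ctilde_pc O ε φ) :=
  isGreatest_sSup_logSet (fun _ hN => hN.2.1)
    ⟨1, pureDistillSet_subset_pureDistillPcSet hφ (one_mem_pureDistillSet hφ hε)⟩

theorem Ctilde_d_le_Ctilde_pc (O : OpClass) (hφ : ‖φ‖ = 1) (hε : 0 ≤ ε) :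
    Ctilde_d O ε φ ≤ Ctilde_pc O ε φ :=
  sSup_logSet_mono (fun _ hN => hN.2.1) ⟨1, one_mem_pureDistillSet hφ hε⟩
    (pureDistillSet_subset_pureDistillPcSet hφ)

theorem Ctilde_pc_le_Ctilde_d_sqrt (O : OpClass) (hφ : ‖φ‖ = 1) (hε : 0 ≤ ε)
    (hr : 1 < coherenceRank φ) :
    Ctilde_pc O ε φ ≤ Ctilde_d O √((coherenceRank φ : ℝ) * (coherenceRank φ - 1) * ε) φ :=
  sSup_logSet_mono (fun _ hN => hN.2.1)
    ⟨1, pureDistillSet_subset_pureDistillPcSet hφ (one_mem_pureDistillSet hφ hε)⟩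
    (pureDistillPcSet_subset_pureDistillSet_sqrt hφ hε hr)

theorem Ctilde_d_eq_Ctilde_d (O O' : OpClass) (ε : ℝ) (hφ : ‖φ‖ = 1) :
    Ctilde_d O ε φ = Ctilde_d O' ε φ :=
  congrArg (fun S => sSup (logSet S)) <| Set.ext fun _ =>
    (mem_pureDistillSet_iff hφ).trans (mem_pureDistillSet_iff hφ).symm

theorem Ctilde_pc_eq_Ctilde_pc (O O' : OpClass) (ε : ℝ) (hφ : ‖φ‖ = 1) :
    Ctilde_pc O ε φ = Ctilde_pc O' ε φ :=
  congrArg (fun S => sSup (logSet S)) <| Set.ext fun _ =>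
    (mem_pureDistillPcSet_iff hφ).trans (mem_pureDistillPcSet_iff hφ).symm

theorem C_d_zero_eq_Ctilde_d_zero (O : OpClass) (hφ : ‖φ‖ = 1) :
    C_d O 0 (proj φ) = Ctilde_d O 0 φ := by
  rw [C_d, Ctilde_d, distillSet_zero_eq_pureDistillSet hφ]

theorem C_pc_zero_eq_Ctilde_pc_zero (O : OpClass) (φ : EuclideanSpace ℂ (Fin d)) :
    C_pc O 0 (proj φ) = Ctilde_pc O 0 φ := by
  rw [C_pc, Ctilde_pc, distillPcSet_zero_eq_pureDistillPcSet]

lemma one_le_floor_inv_maxCoeff (hφ : ‖φ‖ = 1) : 1 ≤ ⌊1 / maxCoeff φ⌋₊ :=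
  (le_floor_inv_maxCoeff_iff hφ le_rfl).2 (by simpa using coeffDist_le_one hφ)

theorem Ctilde_d_zero_eq_logb (O : OpClass) (hφ : ‖φ‖ = 1) :
    Ctilde_d O 0 φ = Real.logb 2 ⌊1 / maxCoeff φ⌋₊ := by
  rw [Ctilde_d, pureDistillSet_zero_eq_Icc hφ, sSup_logSet_Icc (one_le_floor_inv_maxCoeff hφ)]

theorem Ctilde_pc_zero_eq_logb (O : OpClass) (hφ : ‖φ‖ = 1) :
    Ctilde_pc O 0 φ = Real.logb 2 ⌊1 / maxCoeff φ⌋₊ := by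
  rw [Ctilde_pc, pureDistillPcSet_zero_eq_Icc hφ, sSup_logSet_Icc (one_le_floor_inv_maxCoeff hφ)]

end Distillation

end Coherence

end

open Coherence in
theorem theorem3_general {d : ℕ} (φ : EuclideanSpace ℂ (Fin d)) (hφ : ‖φ‖ = 1)
    (r : ℕ) (hr : r = coherenceRank φ) :
    (∀ (O : OpClass) (ε : ℝ), 0 ≤ ε →
      IsGreatest (logSet (pureDistillSet O ε φ)) (Ctilde_d O ε φ) ∧
      IsGreatest (logSet (pureDistillPcSet O ε φ)) (Ctilde_pc O ε φ)) ∧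
    (∀ O : OpClass,
      IsGreatest (logSet (distillSet O 0 (proj φ))) (C_d O 0 (proj φ)) ∧
      IsGreatest (logSet (distillPcSet O 0 (proj φ))) (C_pc O 0 (proj φ))) ∧
    (∀ (O : OpClass) (ε : ℝ), 0 ≤ ε →
      Ctilde_d O ε φ ≤ Ctilde_pc O ε φ ∧
      (1 < r → Ctilde_pc O ε φ ≤ Ctilde_d O √((r : ℝ) * ((r : ℝ) - 1) * ε) φ)) ∧
    (∀ (O O' : OpClass) (ε : ℝ),
      Ctilde_d O ε φ = Ctilde_d O' ε φ ∧ Ctilde_pc O ε φ = Ctilde_pc O' ε φ) ∧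
    (∀ O : OpClass,
      C_d O 0 (proj φ) = Real.logb 2 ⌊1 / maxCoeff φ⌋₊ ∧
      C_pc O 0 (proj φ) = Real.logb 2 ⌊1 / maxCoeff φ⌋₊ ∧
      Ctilde_d O 0 φ = Real.logb 2 ⌊1 / maxCoeff φ⌋₊ ∧
      Ctilde_pc O 0 φ = Real.logb 2 ⌊1 / maxCoeff φ⌋₊) := by
  subst hr
  refine ⟨fun O ε hε => ⟨isGreatest_Ctilde_d O hφ hε, isGreatest_Ctilde_pc O hφ hε⟩,
    fun O => ⟨?_, ?_⟩,
    fun O ε hε => ⟨Ctilde_d_le_Ctilde_pc O hφ hε, Ctilde_pc_le_Ctilde_d_sqrt O hφ hε⟩,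
    fun O O' ε => ⟨Ctilde_d_eq_Ctilde_d O O' ε hφ, Ctilde_pc_eq_Ctilde_pc O O' ε hφ⟩,
    fun O => ?_⟩
  · rw [C_d_zero_eq_Ctilde_d_zero O hφ, distillSet_zero_eq_pureDistillSet hφ]
    exact isGreatest_Ctilde_d O hφ le_rfl
  · rw [C_pc_zero_eq_Ctilde_pc_zero, distillPcSet_zero_eq_pureDistillPcSet]
    exact isGreatest_Ctilde_pc O hφ le_rfl
  · rw [C_d_zero_eq_Ctilde_d_zero O hφ, C_pc_zero_eq_Ctilde_pc_zero, Ctilde_d_zero_eq_logb O hφ,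
      Ctilde_pc_zero_eq_logb O hφ]
    exact ⟨rfl, rfl, rfl, rfl⟩

open Coherence in
theorem theorem3 {d : ℕ} (φ : EuclideanSpace ℂ (Fin d)) (hφ : ‖φ‖ = 1)
    (r : ℕ) (hr : r = coherenceRank φ) (hr1 : 1 < r) :
    -- the suprema in the definitions are attained maxima
    (∀ (O : OpClass) (ε : ℝ), 0 ≤ ε →
      IsGreatest (logSet (pureDistillSet O ε φ)) (Ctilde_d O ε φ) ∧
      IsGreatest (logSet (pureDistillPcSet O ε φ)) (Ctilde_pc O ε φ)) ∧
    (∀ O : OpClass,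
      IsGreatest (logSet (distillSet O 0 (proj φ))) (C_d O 0 (proj φ)) ∧
      IsGreatest (logSet (distillPcSet O 0 (proj φ))) (C_pc O 0 (proj φ))) ∧
    -- smoothed distillation
    (∀ ε : ℝ, 0 ≤ ε → (r : ℝ) * ((r : ℝ) - 1) * ε ≤ 1 →
      (Ctilde_d .incoherent ε φ ≤ Ctilde_pc .incoherent ε φ ∧
        Ctilde_pc .incoherent ε φ ≤ Ctilde_d .incoherent (Real.sqrt ((r : ℝ) * ((r : ℝ) - 1) * ε)) φ) ∧
      Ctilde_d .incoherent ε φ = Ctilde_d .strictlyIncoherent ε φ ∧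
      Ctilde_pc .incoherent ε φ = Ctilde_pc .strictlyIncoherent ε φ) ∧
    -- exact distillation, with arbitrary and with pure output states
    (∀ O : OpClass,
      C_d O 0 (proj φ) = Real.logb 2 ⌊1 / maxCoeff φ⌋₊ ∧
      C_pc O 0 (proj φ) = Real.logb 2 ⌊1 / maxCoeff φ⌋₊ ∧
      Ctilde_d O 0 φ = Real.logb 2 ⌊1 / maxCoeff φ⌋₊ ∧
      Ctilde_pc O 0 φ = Real.logb 2 ⌊1 / maxCoeff φ⌋₊) := by
  obtain ⟨hmax, hmax0, hle, heq, hexact⟩ := theorem3_general φ hφ r hr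
  exact ⟨hmax, hmax0, fun ε hε _ => ⟨⟨(hle _ ε hε).1, (hle _ ε hε).2 hr1⟩, heq _ _ ε⟩, hexact⟩
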